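/- Let $F$ be an infinite field, $V$ a finite-dimensional $F$-vector space, and $\mathcal{A}$ an affine hyperplane arrangement in $V$, i.e. a finite set of affine hyperplanes of $V$. Let $L(\mathcal{A})$ be its intersection poset: the set of all nonempty intersections of hyperplanes of $\mathcal{A}$ (including the empty intersection $\hat 0 = V$), ordered by reverse inclusion, with $r(X) = \operatorname{codim} X$. An ideal of $L(\mathcal{A})$ is a nonempty down-closed subset, and $\langle X\rangle = \{Y \mid Y \le X\}$. The meet-complement of an ideal $\mathcal{I}$ is $\mathcal{I}^c = \{Y \in L(\mathcal{A}) \mid Y \wedge X = \hat 0 \text{ for all } X \in \mathcal{I}\}$. The ideal $\mathcal{I} =: \mathcal{I}_1$ is called modular if, with $\mathcal{I}_2 := \mathcal{I}^c$, (I1) for every $X \in L(\mathcal{A})\setminus\{\hat 0\}$ there are $j \in \{1,2\}$ and $Z \ne \hat 0$ with $\mathcal{I}_j \cap \langle X\rangle = \langle Z\rangle$; (I2) $X_1 \cap X_2 \neq \emptyset$ for all $X_1 \in \mathcal{I}_1$, $X_2 \in \mathcal{I}_2$; (I3) $r(X_1 \cap X_2) = r(X_1) + r(X_2)$ for all $X_1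 \in \mathcal{I}_1$, $X_2 \in \mathcal{I}_2$. Let $\mathcal{K}$ be a commutative ring. The Orlik–Solomon algebra $A(\mathcal{A})$ over $\mathcal{K}$ is the graded algebra $E/I$, where $E$ is the exterior algebra of the free $\mathcal{K}$-module with basis $\{e_H\}_{H\in\mathcal{A}}$, and $I$ is the ideal generated by the products $e_{H_1}\cdots e_{H_p}$ with $H_1\cap\dots\cap H_p = \emptyset$ and by the elements $\sum_{k=1}^p (-1)^{k-1} e_{H_1}\cdots\widehat{e_{H_k}}\cdots e_{H_p}$ for all tuples with $H_1\cap\dots\cap H_p \ne \emptyset$ and $\operatorname{codim}(H_1\cap\dots\cap H_p) < p$. Then for every modular ideal $\mathcal{I}$ of $L(\mathcal{A})$ there exist affine hyperplane arrangements $\mathcal{B}$ and $\mathcal{C}$ in finite-dimensional $F$-vector spaces such that $L(\mathcal{B}) \cong \mathcal{I}$ and $L(\mathcal{C}) \cong \mathcal{I}^c$ as posets and $$A(\mathcal{A}) \cong A(\mathcal{B}) \otimes_{\mathcal{K}} A(\mathcal{C})$$ as graded $\mathcal{K}$-modules. -/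

import Mathlib

open scoped TensorProduct

/-- The codimension of an affine subspace of `V`. -/
noncomputable def affineCodim {F V : Type*} [Field F] [AddCommGroup V] [Module F V]
    (X : AffineSubspace F V) : ℕ :=
  Module.finrank F (V ⧸ X.direction)

/-- A hyperplane arrangement: a finite set of affine hyperplanes of `V`, that is, of nonempty
affine subspaces of codimension one. -/
structure HyperplaneArrangement (F V : Type*) [Field F] [AddCommGroup V] [Module F V] where
  hyperplanes : Finset (AffineSubspace F V)
  ne_bot_of_mem : ∀ H ∈ hyperplanes, H ≠ ⊥
  codim_of_mem : ∀ H ∈ hyperplanes, affineCodim H = 1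

namespace HyperplaneArrangement

variable {F V : Type*} [Field F] [AddCommGroup V] [Module F V]

/-- The nonempty intersections of hyperplanes of `A`. The empty intersection is `V` itself.
They are kept in the order dual of `AffineSubspace F V`, so that they are ordered by reverse
inclusion. -/
def flats (A : HyperplaneArrangement F V) : Set (AffineSubspace F V)ᵒᵈ :=
  {X | OrderDual.ofDual X ≠ ⊥ ∧
    ∃ S : Set (AffineSubspace F V), S ⊆ A.hyperplanes ∧ OrderDual.ofDual X = sInf S}

/-- The intersection poset `L(A)`, ordered by reverse inclusion. -/
abbrev L (A : HyperplaneArrangement F V) : Type _ := A.flats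

/-- The element of the intersection poset, as an affine subspace of `V`. -/
def L.space {A : HyperplaneArrangement F V} (X : A.L) : AffineSubspace F V :=
  OrderDual.ofDual X.1

/-- The order of `L(A)` is reverse inclusion. -/
theorem L.le_iff {A : HyperplaneArrangement F V} (X Y : A.L) : X ≤ Y ↔ Y.space ≤ X.space :=
  Iff.rfl

/-- The least element of `L(A)` is `V`. -/
instance (A : HyperplaneArrangement F V) : OrderBot A.L where
  bot := ⟨OrderDual.toDual ⊤, (bot_ne_top (α := AffineSubspace F V)).symm, ∅,
    Set.empty_subset _, sInf_empty.symm⟩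
  bot_le X := (L.le_iff _ X).2 le_top

/-- The rank of an element of the intersection poset is its codimension. -/
noncomputable def L.rank {A : HyperplaneArrangement F V} (X : A.L) : ℕ := affineCodim X.space

/-- An ideal of `L(A)` is a (nonempty) down-closed subset. -/
def IsIdeal {A : HyperplaneArrangement F V} (I : Set A.L) : Prop := I.Nonempty ∧ IsLowerSet I

/-- Ideal decompositions of `L(A)`. The join of elements of `L(A)` is their intersection, and it
exists if and only if this intersection is nonempty. -/
structure IsIdealDecomposition {A : HyperplaneArrangement F V} {m : ℕ}
    (I : Fin m → Set A.L) : Prop where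
  isIdeal : ∀ j, IsIdeal (I j)
  meet_condition : ∀ X : A.L, X ≠ ⊥ → ∃ j, ∃ Z : A.L, Z ≠ ⊥ ∧ I j ∩ Set.Iic X = Set.Iic Z
  join_condition : ∀ X : Fin m → A.L, (∀ i, X i ∈ I i) → (⨅ i, (X i).space) ≠ ⊥
  rank_condition : ∀ X : Fin m → A.L, (∀ i, X i ∈ I i) →
    affineCodim (⨅ i, (X i).space) = ∑ i, (X i).rank

/-- The meet-complement of `I`: all `Y` whose meet with every `X ∈ I` is the least element. -/
def meetCompl {A : HyperplaneArrangement F V} (I : Set A.L) : Set A.L :=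
  {Y | ∀ X ∈ I, IsGLB {Y, X} ⊥}

/-- `I` is a modular ideal if `I` and its meet-complement form an ideal decomposition. -/
def IsModularIdeal {A : HyperplaneArrangement F V} (I : Set A.L) : Prop :=
  IsIdealDecomposition ![I, meetCompl I]

section OrlikSolomon

variable (K : Type*) [CommRing K] (A : HyperplaneArrangement F V)

/-- The exterior algebra of the free `K`-module on the hyperplanes of `A`. -/
abbrev E : Type _ := ExteriorAlgebra K (A.hyperplanes →₀ K)

/-- The basis element `e_H`. -/
noncomputable def eBasis (H : A.hyperplanes) : E K A :=
  ExteriorAlgebra.ι K (Finsupp.single H 1)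

/-- The product `e_S = e_{H₁} ⋯ e_{Hₚ}` of a tuple `S = (H₁, …, Hₚ)`. -/
noncomputable def eTuple {p : ℕ} (S : Fin p → A.hyperplanes) : E K A :=
  (List.ofFn fun i => eBasis K A (S i)).prod

/-- The boundary map of the exterior algebra: contraction with the linear form that takes every
`e_H` to `1`. -/
noncomputable def boundary : E K A →ₗ[K] E K A :=
  CliffordAlgebra.contractLeft (Finsupp.linearCombination K fun _ => (1 : K))

theorem boundary_one : boundary K A 1 = 0 := CliffordAlgebra.contractLeft_one _ _

/-- The boundary of a product is the alternating sum of the products with one factor removed. -/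
theorem boundary_eTuple {p : ℕ} (S : Fin (p + 1) → A.hyperplanes) :
    boundary K A (eTuple K A S) =
      ∑ k : Fin (p + 1), (-1 : K) ^ (k : ℕ) • eTuple K A (fun i => S (k.succAbove i)) := by
  have key : ∀ {p : ℕ} (S : Fin (p + 1) → A.hyperplanes),
      boundary K A (eTuple K A S) = eTuple K A (fun i => S i.succ)
        - eBasis K A (S 0) * boundary K A (eTuple K A fun i => S i.succ) := by
    intro p S
    rw [eTuple, List.ofFn_succ, List.prod_cons, boundary, eBasis]
    erw [CliffordAlgebra.contractLeft_ι_mul]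
    simp [eTuple, eBasis]
  induction p with
  | zero =>
    rw [key]
    simp [eTuple, boundary_one]
  | succ p ih =>
    rw [key, ih, Finset.mul_sum, sub_eq_add_neg, ← Finset.sum_neg_distrib,
      Fin.sum_univ_succ (n := p + 1)]
    congr 1
    · simp
    · refine Finset.sum_congr rfl fun k _ => ?_
      have : eTuple K A (fun i => S (k.succ.succAbove i)) =
          eBasis K A (S 0) * eTuple K A (fun i => S ((k.succAbove i).succ)) := by
        rw [eTuple, List.ofFn_succ, List.prod_cons]
        simp [eTuple]
      rw [this]
      simp [pow_succ]

/-- The intersection of a tuple of hyperplanes (which is `V` for the empty tuple). -/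
def interTuple {p : ℕ} (S : Fin p → A.hyperplanes) : AffineSubspace F V :=
  ⨅ i, (S i : AffineSubspace F V)

/-- A tuple is dependent if its intersection is nonempty, of codimension less than its length. -/
def IsDependent {p : ℕ} (S : Fin p → A.hyperplanes) : Prop :=
  A.interTuple S ≠ ⊥ ∧ affineCodim (A.interTuple S) < p

/-- The ideal of the exterior algebra generated by the `e_S` with `⋂ S = ∅` and the `∂ e_S` with
`S` dependent. -/
noncomputable def osIdeal : TwoSidedIdeal (E K A) :=
  TwoSidedIdeal.span
    ({x | ∃ (p : ℕ) (S : Fin p → A.hyperplanes), A.interTuple S = ⊥ ∧ x = eTuple K A S} ∪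
     {x | ∃ (p : ℕ) (S : Fin p → A.hyperplanes), A.IsDependent S ∧ x = boundary K A (eTuple K A S)})

/-- The Orlik–Solomon algebra of `A` with coefficients in `K`. -/
abbrev OrlikSolomon : Type _ := (osIdeal K A).ringCon.Quotient

/-- The projection of the exterior algebra onto the Orlik–Solomon algebra, as a linear map. -/
noncomputable def osProj : E K A →ₗ[K] OrlikSolomon K A where
  toFun x := (x : (osIdeal K A).ringCon.Quotient)
  map_add' _ _ := rfl
  map_smul' _ _ := rfl

/-- The component of degree `p` of the Orlik–Solomon algebra: the image of the component of
degree `p` of the exterior algebra. -/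
noncomputable def osDegree (p : ℕ) : Submodule K (OrlikSolomon K A) :=
  (⋀[K]^p (A.hyperplanes →₀ K)).map (osProj K A)

end OrlikSolomon

/-- The component of degree `n` of the tensor product of the Orlik–Solomon algebras of `B` and `C`:
the sum over `p + q = n` of the images of `A_p(B) ⊗ A_q(C)`. -/
noncomputable def osTensorDegree {W W' : Type*} [AddCommGroup W] [Module F W]
    [AddCommGroup W'] [Module F W'] (K : Type*) [CommRing K]
    (B : HyperplaneArrangement F W) (C : HyperplaneArrangement F W') (n : ℕ) :
    Submodule K (OrlikSolomon K B ⊗[K] OrlikSolomon K C) :=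
  ⨆ (p : ℕ) (q : ℕ) (_ : p + q = n),
    LinearMap.range (TensorProduct.map (osDegree K B p).subtype (osDegree K C q).subtype)

end HyperplaneArrangement

/-! Write `I` and `J` for the modular ideal and its meet-complement; they play symmetric roles
throughout. Two independent facts are proved and then combined.

Algebra: every monomial of `A` is a combination of products of a monomial with intersection in `I`
by one with intersection in `J`, and multiplication is injective on the tensors of such monomials.
Both halves rest on one identity in the Orlik–Solomon algebra: if a hyperplane `H` contains the
nonempty intersection of `l`, then `e_H · ∂e_l = e_l`. By (I1) the flats of `I` or of `J` containing
a given flat `X ≠ V` have a least element `Z ≠ V`, and `H` is chosen above `Z`. Spanning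
(`osList_mem_span`) follows by expanding `∂e_l` and inducting on degree. For injectivity
(`mul'_injOn`), the grading of the algebra by flats reduces the question to a fixed join `X`. There
(I3) forces the `I`-part (or the `J`-part) of every monomial to be exactly `Z`, so `∂` on that
factor can be read off from `∂` of the product, and the degree drops.

Geometry: let `Y` be an element of `J` of maximal codimension. A generic translate of `Y` is
transversal to all of `I` by (I3), and over an infinite field it misses every intersection of
hyperplanes of `I` that is not in `I` (`direction_sup_ne_top`). Intersecting the hyperplanes of `I`
with it therefore gives an arrangement `B` realizing `I` (`exists_isRealization`); exchanging the
ideals gives `C`.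

The algebra of a realization embeds in that of `A` with a linear retraction (`exists_section`,
`exists_retraction`), so `A(B) ⊗ A(C) → A(A)` is bijective, over any commutative ring. -/

section AffineCodim

/-! ### Codimension of intersections of affine subspaces -/

variable {F V : Type*} [Field F] [AddCommGroup V] [Module F V]

theorem inf_ne_bot_of_direction_sup_eq_top {X Y : AffineSubspace F V} (hX : X ≠ ⊥) (hY : Y ≠ ⊥)
    (h : X.direction ⊔ Y.direction = ⊤) : X ⊓ Y ≠ ⊥ :=
  (AffineSubspace.nonempty_iff_ne_bot _).1
    (AffineSubspace.inter_nonempty_of_nonempty_of_sup_direction_eq_top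
      ((AffineSubspace.nonempty_iff_ne_bot X).2 hX)
      ((AffineSubspace.nonempty_iff_ne_bot Y).2 hY) h)

variable [FiniteDimensional F V]

theorem affineCodim_add_finrank (X : AffineSubspace F V) :
    affineCodim X + Module.finrank F X.direction = Module.finrank F V :=
  Submodule.finrank_quotient_add_finrank _

theorem affineCodim_anti {X Y : AffineSubspace F V} (h : X ≤ Y) :
    affineCodim Y ≤ affineCodim X := by
  have h1 := affineCodim_add_finrank X
  have h2 := affineCodim_add_finrank Y
  have h3 := Submodule.finrank_mono (AffineSubspace.direction_le h)
  omega

theorem affineCodim_top : affineCodim (⊤ : AffineSubspace F V) = 0 := by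
  have := affineCodim_add_finrank (⊤ : AffineSubspace F V)
  rw [AffineSubspace.direction_top, finrank_top] at this
  omega

theorem AffineSubspace.eq_of_le_of_affineCodim_le {X Y : AffineSubspace F V} (hX : X ≠ ⊥)
    (h : X ≤ Y) (hc : affineCodim X ≤ affineCodim Y) : X = Y := by
  refine AffineSubspace.eq_of_direction_eq_of_nonempty_of_le ?_
    ((AffineSubspace.nonempty_iff_ne_bot X).2 hX) h
  refine Submodule.eq_of_le_of_finrank_le (AffineSubspace.direction_le h) ?_
  have h1 := affineCodim_add_finrank X
  have h2 := affineCodim_add_finrank Y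
  omega

theorem affineCodim_inf_add_finrank_sup {X Y : AffineSubspace F V} (h : X ⊓ Y ≠ ⊥) :
    affineCodim (X ⊓ Y) + Module.finrank F V =
      affineCodim X + affineCodim Y +
        Module.finrank F (X.direction ⊔ Y.direction : Submodule F V) := by
  obtain ⟨p, hp⟩ := (AffineSubspace.nonempty_iff_ne_bot _).2 h
  have h0 := affineCodim_add_finrank (X ⊓ Y)
  have h1 := affineCodim_add_finrank X
  have h2 := affineCodim_add_finrank Y
  have h3 := Submodule.finrank_sup_add_finrank_inf_eq X.direction Y.direction
  rw [AffineSubspace.direction_inf_of_mem_inf hp] at h0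
  omega

theorem affineCodim_inf_le {X Y : AffineSubspace F V} (h : X ⊓ Y ≠ ⊥) :
    affineCodim (X ⊓ Y) ≤ affineCodim X + affineCodim Y := by
  have h1 := affineCodim_inf_add_finrank_sup h
  have h2 := Submodule.finrank_le (X.direction ⊔ Y.direction)
  omega

theorem direction_sup_eq_top_iff {X Y : AffineSubspace F V} (h : X ⊓ Y ≠ ⊥) :
    X.direction ⊔ Y.direction = ⊤ ↔ affineCodim (X ⊓ Y) = affineCodim X + affineCodim Y := by
  have h1 := affineCodim_inf_add_finrank_sup h
  constructor
  · intro h2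
    rw [h2, finrank_top] at h1
    omega
  · intro h2
    apply Submodule.eq_top_of_finrank_eq
    omega

end AffineCodim

/-! ### Avoiding finitely many cosets -/

section CosetAvoidance

open scoped Pointwise

/-- Over an infinite field, finitely many cosets of proper subspaces do not cover the space. -/
theorem exists_forall_sub_notMem {F V ι : Type*} [Field F] [Infinite F] [AddCommGroup V]
    [Module F V] (s : Finset ι) (p : ι → Submodule F V) (g : ι → V) (hp : ∀ i ∈ s, p i ≠ ⊤) :
    ∃ v : V, ∀ i ∈ s, v - g i ∉ p i := by
  by_contra! hcon
  have hcov : ⋃ i ∈ s, (g i) +ᵥ ((p i).toAddSubgroup : Set V) = Set.univ := by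
    refine Set.eq_univ_of_forall fun v => ?_
    obtain ⟨i, hi, hv⟩ := hcon v
    simp only [Set.mem_iUnion]
    refine ⟨i, hi, v - g i, hv, ?_⟩
    simp
  obtain ⟨i, hi, hfi⟩ := AddSubgroup.exists_finiteIndex_of_leftCoset_cover hcov
  have : Finite (V ⧸ p i) := AddSubgroup.finite_quotient_of_finiteIndex
  have : Nontrivial (V ⧸ p i) := Submodule.Quotient.nontrivial_iff.2 (hp i hi)
  have : Infinite (V ⧸ p i) := Module.Free.infinite F (V ⧸ p i)
  exact not_finite (V ⧸ p i)

end CosetAvoidance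

/-! ### Intersections and dependence of lists of hyperplanes -/

namespace HyperplaneArrangement

variable {F V : Type*} [Field F] [AddCommGroup V] [Module F V] (A : HyperplaneArrangement F V)

/-- The intersection of a list of hyperplanes. -/
def inter (l : List A.hyperplanes) : AffineSubspace F V :=
  l.foldr (fun H X => (H : AffineSubspace F V) ⊓ X) ⊤

@[simp] theorem inter_nil : A.inter [] = ⊤ := rfl

@[simp] theorem inter_cons (H : A.hyperplanes) (l : List A.hyperplanes) :
    A.inter (H :: l) = (H : AffineSubspace F V) ⊓ A.inter l := rfl

@[simp] theorem inter_append (l l' : List A.hyperplanes) :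
    A.inter (l ++ l') = A.inter l ⊓ A.inter l' := by
  induction l with
  | nil => simp
  | cons H l ih => simp [ih, inf_assoc]

theorem le_inter_iff {l : List A.hyperplanes} {X : AffineSubspace F V} :
    X ≤ A.inter l ↔ ∀ H ∈ l, X ≤ (H : AffineSubspace F V) := by
  induction l with
  | nil => simp
  | cons H l ih => simp [ih]

theorem inter_le_of_mem {l : List A.hyperplanes} {H : A.hyperplanes} (h : H ∈ l) :
    A.inter l ≤ H := (A.le_inter_iff.1 le_rfl) H h

theorem inter_anti {l l' : List A.hyperplanes} (h : l ⊆ l') : A.inter l' ≤ A.inter l :=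
  A.le_inter_iff.2 fun _ hH => A.inter_le_of_mem (h hH)

theorem inter_le_inter_eraseIdx (l : List A.hyperplanes) (k : ℕ) :
    A.inter l ≤ A.inter (l.eraseIdx k) :=
  A.inter_anti (List.eraseIdx_subset ..)

theorem interTuple_eq_inter {p : ℕ} (S : Fin p → A.hyperplanes) :
    A.interTuple S = A.inter (List.ofFn S) := by
  apply le_antisymm
  · rw [le_inter_iff]
    intro H hH
    obtain ⟨i, rfl⟩ := (List.mem_ofFn' S H).1 hH
    exact iInf_le _ i
  · refine le_iInf fun i => A.inter_le_of_mem ((List.mem_ofFn' S _).2 ⟨i, rfl⟩)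

theorem hyperplane_ne_top [FiniteDimensional F V] (H : A.hyperplanes) :
    (H : AffineSubspace F V) ≠ ⊤ := by
  intro h
  have := A.codim_of_mem _ H.2
  rw [h, affineCodim_top] at this
  omega

/-- A list of hyperplanes is dependent if its intersection is nonempty, of codimension less than
its length. -/
def Dependent (l : List A.hyperplanes) : Prop :=
  A.inter l ≠ ⊥ ∧ affineCodim (A.inter l) < l.length

theorem Dependent.ne_nil {A : HyperplaneArrangement F V} {l : List A.hyperplanes}
    (h : A.Dependent l) : l ≠ [] := by
  rintro rfl
  simpa using h.2

theorem isDependent_iff {p : ℕ} (S : Fin p → A.hyperplanes) :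
    A.IsDependent S ↔ A.Dependent (List.ofFn S) := by
  rw [IsDependent, Dependent, interTuple_eq_inter, List.length_ofFn]

variable [FiniteDimensional F V]

theorem inter_eq_top_iff {l : List A.hyperplanes} : A.inter l = ⊤ ↔ l = [] := by
  cases l with
  | nil => simp
  | cons H l => simp [A.hyperplane_ne_top H]

theorem affineCodim_inter_le {l : List A.hyperplanes} (h : A.inter l ≠ ⊥) :
    affineCodim (A.inter l) ≤ l.length := by
  induction l with
  | nil => simp [affineCodim_top]
  | cons H l ih =>
    have h1 := affineCodim_inf_le (X := (H : AffineSubspace F V)) (Y := A.inter l) h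
    have h2 := ih fun h0 => h (by simp [h0])
    rw [A.codim_of_mem _ H.2] at h1
    simp only [inter_cons, List.length_cons]
    omega

/-- Each further hyperplane raises the length by one and the codimension by at most one. -/
theorem Dependent.append_append {A : HyperplaneArrangement F V} {l : List A.hyperplanes}
    (h : A.Dependent l) (t t' : List A.hyperplanes) (hne : A.inter (t ++ l ++ t') ≠ ⊥) :
    A.Dependent (t ++ l ++ t') := by
  refine ⟨hne, ?_⟩
  rw [inter_append, inter_append] at hne ⊢
  have hne2 : A.inter t ⊓ A.inter l ≠ ⊥ := fun h0 => hne (by simp [h0])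
  have h1 := affineCodim_inf_le hne
  have h2 := affineCodim_inf_le hne2
  have h3 := A.affineCodim_inter_le (l := t) fun h0 => hne2 (by simp [h0])
  have h4 := A.affineCodim_inter_le (l := t') fun h0 => hne (by simp [h0])
  have h5 := h.2
  simp only [List.length_append]
  omega

/-- If the shorter list is independent, its codimension is `l.length - 1`, which is at least that of
`l`, so the two nested flats coincide. This dichotomy makes the Orlik–Solomon relations homogeneous
for the grading by flats. -/
theorem Dependent.eraseIdx {A : HyperplaneArrangement F V} {l : List A.hyperplanes}
    (h : A.Dependent l) {k : ℕ} (hk : k < l.length) :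
    A.Dependent (l.eraseIdx k) ∨ A.inter (l.eraseIdx k) = A.inter l := by
  have hle := A.inter_le_inter_eraseIdx l k
  have hne : A.inter (l.eraseIdx k) ≠ ⊥ := fun h0 => h.1 (le_bot_iff.1 (h0 ▸ hle))
  by_cases hc : affineCodim (A.inter (l.eraseIdx k)) < (l.eraseIdx k).length
  · exact Or.inl ⟨hne, hc⟩
  · right
    refine (AffineSubspace.eq_of_le_of_affineCodim_le h.1 hle ?_).symm
    have := h.2
    rw [List.length_eraseIdx_of_lt hk] at hc
    omega

/-- The relation that this dependent list gives in the Orlik–Solomon algebra is the identity `e_H ·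
∂e_l = e_l`. -/
theorem dependent_cons {l : List A.hyperplanes} {H : A.hyperplanes} (hne : A.inter l ≠ ⊥)
    (hH : A.inter l ≤ H) : A.Dependent (H :: l) := by
  have h : A.inter (H :: l) = A.inter l := inf_eq_right.2 hH
  refine ⟨h ▸ hne, ?_⟩
  rw [h, List.length_cons]
  exact Nat.lt_succ_of_le (A.affineCodim_inter_le hne)

end HyperplaneArrangement

/-! ### Monomials, boundary and the grading by intersections in the exterior algebra -/

/-- A meet semilattice with top element, as a commutative monoid whose product is the meet. -/
@[ext]
structure InfMonoid (α : Type*) where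
  /-- The underlying element. -/
  val : α

instance {α : Type*} [SemilatticeInf α] [OrderTop α] : CommMonoid (InfMonoid α) where
  mul a b := ⟨a.val ⊓ b.val⟩
  one := ⟨⊤⟩
  mul_assoc a b c := InfMonoid.ext (inf_assoc a.val b.val c.val)
  one_mul a := InfMonoid.ext (top_inf_eq a.val)
  mul_one a := InfMonoid.ext (inf_top_eq a.val)
  mul_comm a b := InfMonoid.ext (inf_comm a.val b.val)

/-- This is the condition for extending a map to the exterior algebra. Both hypotheses are needed
because `2` may fail to be invertible in `K`. -/
theorem Finsupp.linearCombination_mul_self_eq_zero {K ι R : Type*} [CommRing K] [Ring R]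
    [Algebra K R] (x : ι → R) (h0 : ∀ i, x i * x i = 0) (h1 : ∀ i j, x i * x j = -(x j * x i))
    (m : ι →₀ K) :
    Finsupp.linearCombination K x m * Finsupp.linearCombination K x m = 0 := by
  have key : ∀ m n : ι →₀ K, Finsupp.linearCombination K x m * Finsupp.linearCombination K x n =
      -(Finsupp.linearCombination K x n * Finsupp.linearCombination K x m) := by
    intro m n
    induction m using Finsupp.induction_linear with
    | zero => simp
    | add a b ha hb => rw [map_add, add_mul, mul_add, ha, hb, neg_add]
    | single i c =>
      induction n using Finsupp.induction_linear with
      | zero => simp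
      | add a b ha hb => rw [map_add, add_mul, mul_add, ha, hb, neg_add]
      | single j d =>
        simp only [Finsupp.linearCombination_single, smul_mul_smul_comm]
        rw [h1 i j, smul_neg, mul_comm c d]
  induction m using Finsupp.induction_linear with
  | zero => simp
  | add a b ha hb => rw [map_add, add_mul, mul_add, mul_add, ha, hb, key a b]; simp
  | single i c => simp [Finsupp.linearCombination_single, h0]

namespace HyperplaneArrangement

variable {F V : Type*} [Field F] [AddCommGroup V] [Module F V] (K : Type*) [CommRing K]
  (A : HyperplaneArrangement F V)

section Exterior

/-- The product of the basis elements of a list of hyperplanes. -/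
noncomputable def eList (l : List A.hyperplanes) : E K A := (l.map (eBasis K A)).prod

@[simp] theorem eList_nil : eList K A [] = 1 := rfl

@[simp] theorem eList_cons (H : A.hyperplanes) (l : List A.hyperplanes) :
    eList K A (H :: l) = eBasis K A H * eList K A l := by simp [eList]

@[simp] theorem eList_append (l l' : List A.hyperplanes) :
    eList K A (l ++ l') = eList K A l * eList K A l' := by simp [eList]

theorem eTuple_eq_eList {p : ℕ} (S : Fin p → A.hyperplanes) :
    eTuple K A S = eList K A (List.ofFn S) := by
  simp [eTuple, eList, List.map_ofFn, Function.comp_def]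

theorem eBasis_mul_self (H : A.hyperplanes) : eBasis K A H * eBasis K A H = 0 :=
  ExteriorAlgebra.ι_sq_zero _

theorem eBasis_mul_comm (H H' : A.hyperplanes) :
    eBasis K A H * eBasis K A H' = -(eBasis K A H' * eBasis K A H) :=
  eq_neg_of_add_eq_zero_left (ExteriorAlgebra.ι_add_mul_swap _ _)

theorem eBasis_mul_eList (H : A.hyperplanes) (l : List A.hyperplanes) :
    eBasis K A H * eList K A l = (-1 : K) ^ l.length • (eList K A l * eBasis K A H) := by
  induction l with
  | nil => simp
  | cons H' l ih =>
    rw [eList_cons, ← mul_assoc, eBasis_mul_comm, neg_mul, mul_assoc, ih, List.length_cons,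
      pow_succ, mul_smul_comm, mul_assoc]
    simp

theorem ι_eq_sum (m : A.hyperplanes →₀ K) :
    ExteriorAlgebra.ι K m = Finsupp.linearCombination K (eBasis K A) m := by
  induction m using Finsupp.induction_linear with
  | zero => simp
  | add a b ha hb => rw [map_add, map_add, ha, hb]
  | single i c =>
    rw [Finsupp.linearCombination_single, eBasis, ← map_smul, Finsupp.smul_single, smul_eq_mul,
      mul_one]

theorem range_ι_eq_span :
    LinearMap.range (ExteriorAlgebra.ι K : (A.hyperplanes →₀ K) →ₗ[K] E K A) =
      Submodule.span K (Set.range (eBasis K A)) := by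
  rw [← Finsupp.range_linearCombination]
  exact congrArg LinearMap.range (LinearMap.ext fun m => ι_eq_sum K A m)

theorem exteriorPower_eq_span (p : ℕ) :
    (⋀[K]^p (A.hyperplanes →₀ K) : Submodule K (E K A)) =
      Submodule.span K (eList K A '' {l | l.length = p}) := by
  rw [ExteriorAlgebra.exteriorPower, range_ι_eq_span, Submodule.span_pow]
  congr 1
  ext x
  rw [Set.mem_pow]
  constructor
  · rintro ⟨f, rfl⟩
    choose g hg using fun i => (f i).2
    refine ⟨List.ofFn g, List.length_ofFn, ?_⟩
    simp [eList, List.map_ofFn, Function.comp_def, hg]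
  · rintro ⟨l, rfl, rfl⟩
    refine ⟨fun i => ⟨eBasis K A (l.get i), l.get i, rfl⟩, ?_⟩
    simp [eList]

theorem span_range_eList : Submodule.span K (Set.range (eList K A)) = ⊤ := by
  have h1 : Algebra.adjoin K (Set.range (eBasis K A)) = ⊤ := by
    rw [eq_top_iff, ← CliffordAlgebra.adjoin_range_ι]
    refine Algebra.adjoin_le ?_
    rintro _ ⟨m, rfl⟩
    have : CliffordAlgebra.ι (0 : QuadraticForm K (A.hyperplanes →₀ K)) m ∈
        Submodule.span K (Set.range (eBasis K A)) := by
      rw [← range_ι_eq_span]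
      exact ⟨m, rfl⟩
    exact Algebra.span_le_adjoin _ _ this
  have h2 := Algebra.adjoin_eq_span K (Set.range (eBasis K A))
  rw [h1, Algebra.top_toSubmodule] at h2
  rw [eq_top_iff, h2]
  refine Submodule.span_mono fun x hx => ?_
  obtain ⟨l, hl, rfl⟩ := Submonoid.exists_list_of_mem_closure hx
  clear hx
  induction l with
  | nil => exact ⟨[], rfl⟩
  | cons y l ih =>
    obtain ⟨t, ht⟩ := ih fun z hz => hl z (List.mem_cons_of_mem _ hz)
    obtain ⟨H, rfl⟩ := hl y List.mem_cons_self
    exact ⟨H :: t, by rw [eList_cons, ht, List.prod_cons]⟩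

variable {K A} in
theorem linearMap_ext_eList {N : Type*} [AddCommMonoid N] [Module K N] {f g : E K A →ₗ[K] N}
    (h : ∀ l, f (eList K A l) = g (eList K A l)) : f = g :=
  LinearMap.ext_on (span_range_eList K A) (by rintro _ ⟨l, rfl⟩; exact h l)

theorem boundary_eBasis_mul (H : A.hyperplanes) (x : E K A) :
    boundary K A (eBasis K A H * x) = x - eBasis K A H * boundary K A x := by
  rw [boundary, eBasis]
  erw [CliffordAlgebra.contractLeft_ι_mul]
  simp

theorem boundary_boundary (x : E K A) : boundary K A (boundary K A x) = 0 :=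
  CliffordAlgebra.contractLeft_contractLeft _ _

theorem boundary_eList_mul (l : List A.hyperplanes) (x : E K A) :
    boundary K A (eList K A l * x) = boundary K A (eList K A l) * x +
      (-1 : K) ^ l.length • (eList K A l * boundary K A x) := by
  induction l with
  | nil => simp [boundary_one]
  | cons H l ih =>
    rw [eList_cons, mul_assoc, boundary_eBasis_mul, boundary_eBasis_mul, ih, List.length_cons,
      pow_succ]
    simp only [mul_add, sub_mul, mul_assoc, mul_smul_comm, mul_neg, mul_one, neg_smul]
    abel

theorem boundary_eList (l : List A.hyperplanes) :
    boundary K A (eList K A l) =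
      ∑ k ∈ Finset.range l.length, (-1 : K) ^ k • eList K A (l.eraseIdx k) := by
  induction l with
  | nil => simp [boundary_one]
  | cons H l ih =>
    rw [eList_cons, boundary_eBasis_mul, ih, List.length_cons, Finset.sum_range_succ',
      Finset.mul_sum]
    simp only [List.eraseIdx_cons_succ, List.eraseIdx_zero, List.tail_cons, eList_cons, pow_zero,
      one_smul, pow_succ, mul_neg, mul_one, neg_smul, Finset.sum_neg_distrib, mul_smul_comm]
    abel

/-- A nonempty monomial is a multiple of its own boundary, so killing the boundaries of dependent
monomials also kills these monomials. -/
theorem eBasis_mul_boundary {H : A.hyperplanes} (l : List A.hyperplanes) :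
    eBasis K A H * boundary K A (eList K A (H :: l)) = eList K A (H :: l) := by
  rw [eList_cons, boundary_eBasis_mul, mul_sub, ← mul_assoc, eBasis_mul_self]
  simp

/-- The coaction of the monoid of affine subspaces on the exterior algebra, which sends each
monomial to its tensor product with the intersection of its factors. -/
noncomputable def coaction :
    E K A →ₐ[K] E K A ⊗[K] MonoidAlgebra K (InfMonoid (AffineSubspace F V)) :=
  ExteriorAlgebra.lift K ⟨Finsupp.linearCombination K fun H =>
      eBasis K A H ⊗ₜ[K] MonoidAlgebra.of K (InfMonoid (AffineSubspace F V)) ⟨H.1⟩,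
    Finsupp.linearCombination_mul_self_eq_zero _
      (fun H => by
        rw [Algebra.TensorProduct.tmul_mul_tmul, eBasis_mul_self, TensorProduct.zero_tmul])
      (fun H H' => by
        rw [Algebra.TensorProduct.tmul_mul_tmul, Algebra.TensorProduct.tmul_mul_tmul,
          eBasis_mul_comm, TensorProduct.neg_tmul, ← map_mul, ← map_mul,
          mul_comm (⟨H.1⟩ : InfMonoid (AffineSubspace F V))])⟩

theorem coaction_eList (l : List A.hyperplanes) :
    coaction K A (eList K A l) =
      eList K A l ⊗ₜ[K] MonoidAlgebra.of K (InfMonoid (AffineSubspace F V)) ⟨A.inter l⟩ := by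
  induction l with
  | nil =>
    rw [eList_nil, map_one, inter_nil]
    rfl
  | cons H l ih =>
    have h : coaction K A (eBasis K A H) =
        eBasis K A H ⊗ₜ[K] MonoidAlgebra.of K (InfMonoid (AffineSubspace F V)) ⟨H.1⟩ := by
      rw [coaction, eBasis, ExteriorAlgebra.lift_ι_apply, Finsupp.linearCombination_single,
        one_smul, eBasis]
    rw [eList_cons, map_mul, ih, h, Algebra.TensorProduct.tmul_mul_tmul, ← map_mul]
    rfl

open Classical in
/-- The projection of the exterior algebra onto the span of the monomials whose intersection
satisfies `P`. -/
noncomputable def extProj (P : AffineSubspace F V → Prop) : E K A →ₗ[K] E K A :=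
  (TensorProduct.rid K (E K A)).toLinearMap ∘ₗ
    LinearMap.lTensor (E K A) ((Finsupp.linearCombination K
      fun X : InfMonoid (AffineSubspace F V) => if P X.val then (1 : K) else 0) ∘ₗ
        (MonoidAlgebra.coeffLinearEquiv K).toLinearMap) ∘ₗ
    (coaction K A).toLinearMap

open Classical in
theorem extProj_eList (P : AffineSubspace F V → Prop) (l : List A.hyperplanes) :
    extProj K A P (eList K A l) = if P (A.inter l) then eList K A l else 0 := by
  simp only [extProj, LinearMap.comp_apply, AlgHom.toLinearMap_apply, coaction_eList,
    LinearMap.lTensor_tmul, LinearEquiv.coe_coe, TensorProduct.rid_tmul]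
  rw [MonoidAlgebra.of_apply]
  erw [Finsupp.linearCombination_single]
  split_ifs <;> simp

end Exterior

end HyperplaneArrangement

/-! ### Grading by flats and boundary on the Orlik–Solomon algebra -/

namespace HyperplaneArrangement

variable {F V : Type*} [Field F] [AddCommGroup V] [Module F V] (K : Type*) [CommRing K]
  (A : HyperplaneArrangement F V)

section OrlikSolomonMonomials

theorem osProj_mul (x y : E K A) : osProj K A (x * y) = osProj K A x * osProj K A y := rfl

theorem osProj_surjective : Function.Surjective (osProj K A) := Quotient.mk_surjective

theorem osProj_eq_zero_iff {x : E K A} : osProj K A x = 0 ↔ x ∈ osIdeal K A := by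
  rw [TwoSidedIdeal.mem_iff]
  exact RingCon.eq _

/-- The image in the Orlik–Solomon algebra of the monomial of a list of hyperplanes. -/
noncomputable def osList (l : List A.hyperplanes) : OrlikSolomon K A := osProj K A (eList K A l)

theorem osList_append (l l' : List A.hyperplanes) :
    osList K A (l ++ l') = osList K A l * osList K A l' := by
  simp [osList, osProj_mul]

theorem osList_cons (H : A.hyperplanes) (l : List A.hyperplanes) :
    osList K A (H :: l) = osList K A [H] * osList K A l :=
  osList_append K A [H] l

theorem span_range_osList : Submodule.span K (Set.range (osList K A)) = ⊤ := by
  have h : Set.range (osList K A) = osProj K A '' Set.range (eList K A) := by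
    rw [← Set.range_comp]
    rfl
  rw [h, Submodule.span_image, span_range_eList, Submodule.map_top, LinearMap.range_eq_top]
  exact osProj_surjective K A

theorem osDegree_eq_span (p : ℕ) :
    osDegree K A p = Submodule.span K (osList K A '' {l | l.length = p}) := by
  rw [osDegree, exteriorPower_eq_span, ← Submodule.span_image, ← Set.image_comp]
  rfl

variable {K A}

theorem linearMap_ext_osList {N : Type*} [AddCommMonoid N] [Module K N]
    {f g : OrlikSolomon K A →ₗ[K] N} (h : ∀ l, f (osList K A l) = g (osList K A l)) : f = g :=
  LinearMap.ext_on (span_range_osList K A) (by rintro _ ⟨l, rfl⟩; exact h l)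

theorem osList_eq_zero_of_inter_eq_bot {l : List A.hyperplanes} (h : A.inter l = ⊥) :
    osList K A l = 0 := by
  rw [osList, osProj_eq_zero_iff]
  refine TwoSidedIdeal.subset_span (Or.inl ⟨l.length, l.get, ?_, ?_⟩)
  · rw [interTuple_eq_inter, List.ofFn_get, h]
  · rw [eTuple_eq_eList, List.ofFn_get]

theorem osProj_boundary_of_dependent {l : List A.hyperplanes} (h : A.Dependent l) :
    osProj K A (boundary K A (eList K A l)) = 0 := by
  rw [osProj_eq_zero_iff]
  refine TwoSidedIdeal.subset_span (Or.inr ⟨l.length, l.get, ?_, ?_⟩)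
  · rw [isDependent_iff, List.ofFn_get]
    exact h
  · rw [eTuple_eq_eList, List.ofFn_get]

theorem osList_eq_zero_of_dependent {l : List A.hyperplanes} (h : A.Dependent l) :
    osList K A l = 0 := by
  obtain ⟨H, t, rfl⟩ := List.exists_cons_of_ne_nil h.ne_nil
  rw [osList, ← eBasis_mul_boundary, osProj_mul, osProj_boundary_of_dependent h, mul_zero]

/-- A linear map on the exterior algebra descends to the Orlik–Solomon algebra as soon as it
kills the multiples of the generators by monomials. -/
theorem exists_osLift {N : Type*} [AddCommGroup N] [Module K N] (f : E K A →ₗ[K] N)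
    (hbot : ∀ l, A.inter l = ⊥ → f (eList K A l) = 0)
    (hdep : ∀ t l t', A.Dependent l →
      f (eList K A t * boundary K A (eList K A l) * eList K A t') = 0) :
    ∃ g : OrlikSolomon K A →ₗ[K] N, ∀ x, g (osProj K A x) = f x := by
  -- The largest two-sided ideal contained in the kernel of `f`; it suffices that it contains the
  -- generators.
  let J : TwoSidedIdeal (E K A) := TwoSidedIdeal.mk' {z | ∀ a b, f (a * z * b) = 0}
    (by simp) (fun hx hy a b => by rw [mul_add, add_mul, map_add, hx, hy, add_zero])
    (fun hx a b => by rw [mul_neg, neg_mul, map_neg, hx, neg_zero])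
    (fun {x y} hy a b => by rw [← mul_assoc]; exact hy _ _)
    (fun {x y} hx a b => by rw [← mul_assoc, mul_assoc]; exact hx _ _)
  have hmon : ∀ z, (∀ t t', f (eList K A t * z * eList K A t') = 0) → z ∈ J := by
    intro z hz
    rw [TwoSidedIdeal.mem_mk']
    intro a b
    have h1 : ∀ t, f ∘ₗ LinearMap.mulLeft K (eList K A t * z) = 0 := fun t =>
      linearMap_ext_eList fun t' => hz t t'
    have h2 : f ∘ₗ LinearMap.mulRight K b ∘ₗ LinearMap.mulRight K z = 0 :=
      linearMap_ext_eList fun t => LinearMap.congr_fun (h1 t) b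
    exact LinearMap.congr_fun h2 a
  have hle : osIdeal K A ≤ J := by
    refine TwoSidedIdeal.span_le.2 ?_
    rintro _ (⟨p, S, hS, rfl⟩ | ⟨p, S, hS, rfl⟩)
    · refine hmon _ fun t t' => ?_
      rw [eTuple_eq_eList, ← eList_append, ← eList_append]
      refine hbot _ ?_
      rw [interTuple_eq_inter] at hS
      simp [hS]
    · refine hmon _ fun t t' => ?_
      rw [eTuple_eq_eList]
      exact hdep _ _ _ ((isDependent_iff A S).1 hS)
  have hker : LinearMap.ker (osProj K A) ≤ LinearMap.ker f := by
    intro x hx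
    rw [LinearMap.mem_ker, osProj_eq_zero_iff] at hx
    have := (TwoSidedIdeal.mem_mk' _ _ _ _ _ _ _).1 (hle hx) 1 1
    rwa [one_mul, mul_one] at this
  refine ⟨(LinearMap.ker (osProj K A)).liftQ f hker ∘ₗ
    ((osProj K A).quotKerEquivOfSurjective (osProj_surjective K A)).symm.toLinearMap, fun x => ?_⟩
  have : ((osProj K A).quotKerEquivOfSurjective (osProj_surjective K A)).symm (osProj K A x) =
      Submodule.Quotient.mk x := by
    rw [LinearEquiv.symm_apply_eq]
    rfl
  simp only [LinearMap.comp_apply, LinearEquiv.coe_coe, this]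
  exact Submodule.liftQ_apply _ _ _

theorem mul_boundary_mul_eq_sum (t l t' : List A.hyperplanes) :
    eList K A t * boundary K A (eList K A l) * eList K A t' =
      ∑ k ∈ Finset.range l.length, (-1 : K) ^ k • eList K A (t ++ l.eraseIdx k ++ t') := by
  simp only [boundary_eList, Finset.mul_sum, Finset.sum_mul, eList_append, mul_smul_comm,
    smul_mul_assoc]

theorem osList_singleton_mul_comm (H : A.hyperplanes) (l : List A.hyperplanes) :
    osList K A [H] * osList K A l = (-1 : K) ^ l.length • (osList K A l * osList K A [H]) := by
  have := congrArg (osProj K A) (eBasis_mul_eList K A H l)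
  simpa [osList, osProj_mul] using this

variable [FiniteDimensional F V]

open Classical in
-- By `Dependent.eraseIdx`, a term of `∂e_l` either vanishes in the quotient or has the same
-- intersection as `l`. Modulo the vanishing terms, the projection keeps or kills the relation as a
-- whole.
theorem osProj_extProj_mul_boundary_mul (P : AffineSubspace F V → Prop)
    (t l t' : List A.hyperplanes) (h : A.Dependent l) :
    osProj K A (extProj K A P (eList K A t * boundary K A (eList K A l) * eList K A t')) = 0 := by
  have key : osProj K A (extProj K A P
      (eList K A t * boundary K A (eList K A l) * eList K A t')) =
      if P (A.inter (t ++ l ++ t')) then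
        osProj K A (eList K A t * boundary K A (eList K A l) * eList K A t') else 0 := by
    simp only [mul_boundary_mul_eq_sum, map_sum, map_smul, extProj_eList]
    trans ∑ k ∈ Finset.range l.length, if P (A.inter (t ++ l ++ t')) then
      (-1 : K) ^ k • osProj K A (eList K A (t ++ l.eraseIdx k ++ t')) else 0
    · refine Finset.sum_congr rfl fun k hk => ?_
      rcases h.eraseIdx (Finset.mem_range.1 hk) with hdep | heq
      · have h0 : osProj K A (eList K A (t ++ l.eraseIdx k ++ t')) = 0 := by
          have := osList_eq_zero_of_dependent (K := K) hdep
          rw [osList] at this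
          rw [eList_append, eList_append, osProj_mul, osProj_mul, this, mul_zero, zero_mul]
        rw [apply_ite (osProj K A), h0, map_zero, ite_self, smul_zero, ite_self]
      · simp only [inter_append, heq]
        split_ifs <;> simp
    · split_ifs <;> simp
  rw [key, osProj_mul, osProj_mul, osProj_boundary_of_dependent h, mul_zero, zero_mul, ite_self]

open Classical in
variable (K A) in
theorem exists_gradeProj (P : AffineSubspace F V → Prop) :
    ∃ f : OrlikSolomon K A →ₗ[K] OrlikSolomon K A,
      ∀ l, f (osList K A l) = if P (A.inter l) then osList K A l else 0 := by
  obtain ⟨f, hf⟩ := exists_osLift (osProj K A ∘ₗ extProj K A P)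
    (fun l hl => by
      rw [LinearMap.comp_apply, extProj_eList]
      split_ifs
      · exact osList_eq_zero_of_inter_eq_bot hl
      · exact map_zero _)
    (fun t l t' => osProj_extProj_mul_boundary_mul P t l t')
  refine ⟨f, fun l => ?_⟩
  rw [osList, hf, LinearMap.comp_apply, extProj_eList, apply_ite (osProj K A), map_zero]

/-- The projection of the Orlik–Solomon algebra onto the span of the monomials whose intersection
satisfies `P`. -/
noncomputable def gradeProj (P : AffineSubspace F V → Prop) :
    OrlikSolomon K A →ₗ[K] OrlikSolomon K A :=
  (exists_gradeProj K A P).choose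

open Classical in
theorem gradeProj_osList (P : AffineSubspace F V → Prop) (l : List A.hyperplanes) :
    gradeProj P (osList K A l) = if P (A.inter l) then osList K A l else 0 :=
  (exists_gradeProj K A P).choose_spec l

variable (K A) in
-- The boundary itself need not descend: a monomial with empty intersection is zero in the quotient,
-- but its boundary may survive. Projecting away those monomials before applying the boundary
-- repairs this, and changes nothing on monomials with nonempty intersection.
theorem exists_osBoundary : ∃ D : OrlikSolomon K A →ₗ[K] OrlikSolomon K A,
    ∀ l, A.inter l ≠ ⊥ → D (osList K A l) = osProj K A (boundary K A (eList K A l)) := by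
  classical
  suffices h : ∃ D : OrlikSolomon K A →ₗ[K] OrlikSolomon K A, ∀ x, D (osProj K A x) =
      (osProj K A ∘ₗ boundary K A ∘ₗ extProj K A fun X => X ≠ ⊥) x by
    obtain ⟨D, hD⟩ := h
    refine ⟨D, fun l hl => ?_⟩
    rw [osList, hD, LinearMap.comp_apply, LinearMap.comp_apply, extProj_eList, if_pos hl]
  refine exists_osLift _ ?_ ?_
  · intro l hl
    simp [extProj_eList, hl]
  · intro t l t' h
    by_cases hne : A.inter (t ++ l ++ t') = ⊥
    · simp only [LinearMap.comp_apply, mul_boundary_mul_eq_sum, map_sum, map_smul, extProj_eList]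
      refine Finset.sum_eq_zero fun k hk => ?_
      split_ifs with hk'
      -- A term with nonempty intersection must come from a dependent shorter list, since otherwise
      -- it would have the empty intersection of the whole list.
      · rcases h.eraseIdx (Finset.mem_range.1 hk) with hdep | heq
        · rw [osProj_boundary_of_dependent (hdep.append_append t t' hk'), smul_zero]
        · rw [inter_append, inter_append, heq, ← inter_append, ← inter_append] at hk'
          exact absurd hne hk'
      · simp
    · have hext : extProj K A (fun X => X ≠ ⊥)
          (eList K A t * boundary K A (eList K A l) * eList K A t') =
          eList K A t * boundary K A (eList K A l) * eList K A t' := by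
        simp only [mul_boundary_mul_eq_sum, map_sum, map_smul, extProj_eList]
        refine Finset.sum_congr rfl fun k _ => ?_
        rw [if_pos]
        refine fun h0 => hne (le_bot_iff.1 (h0 ▸ ?_))
        simp only [inter_append]
        gcongr
        exact A.inter_le_inter_eraseIdx l k
      rw [LinearMap.comp_apply, LinearMap.comp_apply, hext]
      have hb := osProj_boundary_of_dependent (K := K) h
      -- The Leibniz rule with `∂e_l` as left factor, obtained by applying `∂` to the rule for `e_l
      -- · e_t'` and using `∂² = 0`.
      have h1 : boundary K A (boundary K A (eList K A l) * eList K A t') =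
        (-1 : K) ^ (l.length + 1) • (boundary K A (eList K A l) * boundary K A (eList K A t')) := by
        have h2 := congrArg (boundary K A) (boundary_eList_mul K A l (eList K A t'))
        rw [boundary_boundary, map_add, map_smul, boundary_eList_mul, boundary_boundary] at h2
        rw [eq_neg_of_add_eq_zero_left h2.symm, mul_zero, smul_zero, add_zero, pow_succ]
        simp
      rw [mul_assoc, boundary_eList_mul, h1]
      simp [osProj_mul, hb]

/-- The linear map of the Orlik–Solomon algebra that agrees with the boundary map on the monomials
with nonempty intersection. -/
noncomputable def osBoundary : OrlikSolomon K A →ₗ[K] OrlikSolomon K A :=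
  (exists_osBoundary K A).choose

theorem osBoundary_osList {l : List A.hyperplanes} (h : A.inter l ≠ ⊥) :
    osBoundary (osList K A l) = osProj K A (boundary K A (eList K A l)) :=
  (exists_osBoundary K A).choose_spec l h

theorem osBoundary_osList_eq_sum {l : List A.hyperplanes} (h : A.inter l ≠ ⊥) :
    osBoundary (osList K A l) =
      ∑ k ∈ Finset.range l.length, (-1 : K) ^ k • osList K A (l.eraseIdx k) := by
  rw [osBoundary_osList h, boundary_eList, map_sum]
  exact Finset.sum_congr rfl fun k _ => map_smul _ _ _

/-- If the hyperplane `H` contains the nonempty intersection of `l`, then multiplication by `e_H`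
recovers the monomial of `l` from its boundary. -/
theorem osList_singleton_mul_osBoundary {l : List A.hyperplanes} {H : A.hyperplanes}
    (h : A.inter l ≠ ⊥) (hH : A.inter l ≤ H) :
    osList K A [H] * osBoundary (osList K A l) = osList K A l := by
  have h1 := osProj_boundary_of_dependent (K := K) (A.dependent_cons h hH)
  rw [eList_cons, boundary_eBasis_mul, map_sub, sub_eq_zero] at h1
  rw [osBoundary_osList h, osList, osList, h1, ← osProj_mul]
  simp

theorem osBoundary_osList_append {l l' : List A.hyperplanes} (h : A.inter (l ++ l') ≠ ⊥) :
    osBoundary (osList K A (l ++ l')) = osBoundary (osList K A l) * osList K A l' +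
      (-1 : K) ^ l.length • (osList K A l * osBoundary (osList K A l')) := by
  rw [osBoundary_osList h, osBoundary_osList, osBoundary_osList, eList_append, boundary_eList_mul]
  · simp [osList, osProj_mul]
  · rw [inter_append] at h
    exact fun h0 => h (by simp [h0])
  · rw [inter_append] at h
    exact fun h0 => h (by simp [h0])

end OrlikSolomonMonomials

end HyperplaneArrangement

theorem LinearMap.apply_mem_of_mem_span {K M N : Type*} [Semiring K] [AddCommMonoid M]
    [AddCommMonoid N] [Module K M] [Module K N] (f : M →ₗ[K] N) {S : Set M} {P : Submodule K N}
    (h : ∀ x ∈ S, f x ∈ P) {x : M} (hx : x ∈ Submodule.span K S) : f x ∈ P :=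
  (Submodule.span_le.2 h : _ ≤ P.comap f) hx

/-! ### Decompositions into two ideals: spanning and injectivity of multiplication -/

namespace HyperplaneArrangement

variable {F V : Type*} [Field F] [AddCommGroup V] [Module F V]

/-- Among the elements of `I` above `X` there is a least one, and it lies in a hyperplane. -/
def HasLeastAbove (A : HyperplaneArrangement F V) (I : Set (AffineSubspace F V))
    (X : AffineSubspace F V) : Prop :=
  ∃ Z ∈ I, ∃ H : A.hyperplanes, Z ≤ H ∧ X ≤ Z ∧ ∀ Y ∈ I, X ≤ Y → Z ≤ Y

/-- Decompositions of the intersection poset into two ideals, in terms of affine subspaces. -/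
structure IsDecomposition (A : HyperplaneArrangement F V) (I J : Set (AffineSubspace F V)) :
    Prop where
  top_mem_left : ⊤ ∈ I
  top_mem_right : ⊤ ∈ J
  exists_inter_left : ∀ X ∈ I, ∃ l, X = A.inter l
  exists_inter_right : ∀ X ∈ J, ∃ l, X = A.inter l
  inter_mem_left : ∀ X ∈ I, ∀ l, X ≤ A.inter l → A.inter l ∈ I
  inter_mem_right : ∀ X ∈ J, ∀ l, X ≤ A.inter l → A.inter l ∈ J
  hasLeastAbove : ∀ l, l ≠ [] → A.inter l ≠ ⊥ →
    A.HasLeastAbove I (A.inter l) ∨ A.HasLeastAbove J (A.inter l)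
  inf_ne_bot : ∀ X ∈ I, ∀ Y ∈ J, X ⊓ Y ≠ ⊥
  affineCodim_inf : ∀ X ∈ I, ∀ Y ∈ J, affineCodim (X ⊓ Y) = affineCodim X + affineCodim Y

namespace IsDecomposition

variable {A : HyperplaneArrangement F V} {I J : Set (AffineSubspace F V)}

theorem symm (h : A.IsDecomposition I J) : A.IsDecomposition J I where
  top_mem_left := h.top_mem_right
  top_mem_right := h.top_mem_left
  exists_inter_left := h.exists_inter_right
  exists_inter_right := h.exists_inter_left
  inter_mem_left := h.inter_mem_right
  inter_mem_right := h.inter_mem_left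
  hasLeastAbove l hl hne := (h.hasLeastAbove l hl hne).symm
  inf_ne_bot X hX Y hY := inf_comm X Y ▸ h.inf_ne_bot Y hY X hX
  affineCodim_inf X hX Y hY := by rw [inf_comm, h.affineCodim_inf Y hY X hX, add_comm]

theorem ne_bot_left (h : A.IsDecomposition I J) {X : AffineSubspace F V} (hX : X ∈ I) : X ≠ ⊥ :=
  inf_top_eq X ▸ h.inf_ne_bot X hX ⊤ h.top_mem_right

theorem ne_bot_right (h : A.IsDecomposition I J) {X : AffineSubspace F V} (hX : X ∈ J) : X ≠ ⊥ :=
  h.symm.ne_bot_left hX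

/-- The components of a join in the two ideals are determined by the join where it has a largest
element of the ideal below it. -/
theorem eq_of_inf_eq [FiniteDimensional F V] (h : A.IsDecomposition I J)
    {X Y Z : AffineSubspace F V} (hX : X ∈ I) (hY : Y ∈ J) (hZ : Z ∈ I) (hle : X ⊓ Y ≤ Z)
    (hmin : ∀ W ∈ I, X ⊓ Y ≤ W → Z ≤ W) : X = Z := by
  have hZX : Z ≤ X := hmin X hX inf_le_left
  refine (AffineSubspace.eq_of_le_of_affineCodim_le (h.ne_bot_left hZ) hZX ?_).symm
  have h1 := h.affineCodim_inf X hX Y hY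
  have h2 := h.affineCodim_inf Z hZ Y hY
  -- `Z ⊓ Y = X ⊓ Y`, so additivity of codimension gives `X` and `Z` the same codimension.
  rw [le_antisymm (inf_le_inf_right Y hZX) (le_inf hle inf_le_right)] at h2
  omega

variable (K : Type*) [CommRing K] [FiniteDimensional F V]

/-- Every monomial is a linear combination of products of a monomial of `I` by one of `J`. -/
theorem osList_mem_span (h : A.IsDecomposition I J) (n : ℕ) :
    ∀ l : List A.hyperplanes, l.length = n → osList K A l ∈ Submodule.span K
      {x | ∃ t t', A.inter t ∈ I ∧ A.inter t' ∈ J ∧ t.length + t'.length = n ∧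
        A.inter l ≤ A.inter t ∧ A.inter l ≤ A.inter t' ∧ x = osList K A t * osList K A t'} := by
  induction n with
  | zero =>
    intro l hl
    rw [List.length_eq_zero_iff] at hl
    subst hl
    refine Submodule.subset_span ⟨[], [], h.top_mem_left, h.top_mem_right, rfl, le_rfl, le_rfl, ?_⟩
    rw [← osList_append, List.append_nil]
  | succ n ih =>
    intro l hl
    by_cases hne : A.inter l = ⊥
    · rw [osList_eq_zero_of_inter_eq_bot hne]
      exact zero_mem _
    have hlen : ∀ k ∈ Finset.range l.length, (l.eraseIdx k).length = n := fun k hk => by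
      rw [List.length_eraseIdx_of_lt (Finset.mem_range.1 hk), hl, Nat.add_sub_cancel]
    rcases h.hasLeastAbove l (by rintro rfl; simp at hl) hne with
      ⟨Z, hZ, H, hZH, hlZ, hmin⟩ | ⟨Z, hZ, H, hZH, hlZ, hmin⟩
    -- Replace `e_l` by `e_H · ∂e_l` and decompose each term of the boundary by induction.
    · rw [← osList_singleton_mul_osBoundary hne (hlZ.trans hZH), osBoundary_osList_eq_sum hne,
        Finset.mul_sum]
      refine Submodule.sum_mem _ fun k hk => ?_
      rw [mul_smul_comm]
      refine Submodule.smul_mem _ _ ?_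
      refine (LinearMap.mulLeft K (osList K A [H])).apply_mem_of_mem_span ?_ (ih _ (hlen k hk))
      rintro _ ⟨t, t', ht, ht', hs, hlt, hlt', rfl⟩
      have hlk := A.inter_le_inter_eraseIdx l k
      -- The inductive bound `A.inter l ≤ A.inter t` is carried for this: minimality of `Z` then
      -- puts `H :: t` below a single element of the ideal, so its intersection stays in the ideal.
      have hZt : Z ≤ A.inter (H :: t) := le_inf hZH (hmin _ ht (hlk.trans hlt))
      refine Submodule.subset_span ⟨H :: t, t', h.inter_mem_left Z hZ _ hZt, ht', ?_,
        hlZ.trans hZt, hlk.trans hlt', ?_⟩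
      · rw [List.length_cons]
        omega
      · rw [osList_cons K A H t, LinearMap.mulLeft_apply, mul_assoc]
    · rw [← osList_singleton_mul_osBoundary hne (hlZ.trans hZH), osBoundary_osList_eq_sum hne,
        Finset.mul_sum]
      refine Submodule.sum_mem _ fun k hk => ?_
      rw [mul_smul_comm]
      refine Submodule.smul_mem _ _ ?_
      refine (LinearMap.mulLeft K (osList K A [H])).apply_mem_of_mem_span ?_ (ih _ (hlen k hk))
      rintro _ ⟨t, t', ht, ht', hs, hlt, hlt', rfl⟩
      have hlk := A.inter_le_inter_eraseIdx l k
      have hZt : Z ≤ A.inter (H :: t') := le_inf hZH (hmin _ ht' (hlk.trans hlt'))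
      -- Here `e_H` belongs with the second factor and is moved past `e_t` at the cost of a sign.
      rw [LinearMap.mulLeft_apply, ← mul_assoc,
        osList_singleton_mul_comm, smul_mul_assoc, mul_assoc, ← osList_cons]
      refine Submodule.smul_mem _ _ (Submodule.subset_span ⟨t, H :: t', ht,
        h.inter_mem_right Z hZ _ hZt, ?_, hlk.trans hlt, hlZ.trans hZt, rfl⟩)
      rw [List.length_cons]
      omega

variable (A I J) in
/-- The tensors of a monomial of `I` by a monomial of `J`, of total length `n`. -/
def tensorMonomials (n : ℕ) : Set (OrlikSolomon K A ⊗[K] OrlikSolomon K A) :=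
  {y | ∃ t t', A.inter t ∈ I ∧ A.inter t' ∈ J ∧ t.length + t'.length = n ∧
    y = osList K A t ⊗ₜ[K] osList K A t'}

variable (A I J) in
/-- The tensors of a monomial of `I` by a monomial of `J`, of total length `n`, with join `X`. -/
def tensorMonomialsAt (n : ℕ) (X : AffineSubspace F V) :
    Set (OrlikSolomon K A ⊗[K] OrlikSolomon K A) :=
  {y | ∃ t t', A.inter t ∈ I ∧ A.inter t' ∈ J ∧ t.length + t'.length = n ∧
    A.inter t ⊓ A.inter t' = X ∧ y = osList K A t ⊗ₜ[K] osList K A t'}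

/-- Otherwise additivity of codimension would make the codimension of the independent list `t` at
most that of a list with one element fewer. -/
theorem not_inf_le (h : A.IsDecomposition I J) {t : List A.hyperplanes} {X : AffineSubspace F V}
    (ht : A.inter t ∈ I) (hX : X ∈ J) (hdep : ¬ A.Dependent t) {k : ℕ} (hk : k < t.length) :
    ¬ A.inter (t.eraseIdx k) ⊓ X ≤ A.inter t := by
  intro hle
  have hY : A.inter (t.eraseIdx k) ∈ I := h.inter_mem_left _ ht _ (A.inter_le_inter_eraseIdx t k)
  have h1 := affineCodim_anti (le_inf hle inf_le_right)
  rw [h.affineCodim_inf _ ht _ hX, h.affineCodim_inf _ hY _ hX] at h1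
  have h2 := A.affineCodim_inter_le (h.ne_bot_left hY)
  rw [List.length_eraseIdx_of_lt hk] at h2
  have h3 : t.length ≤ affineCodim (A.inter t) :=
    not_lt.1 fun h0 => hdep ⟨h.ne_bot_left ht, h0⟩
  omega

/-- The Leibniz rule splits `∂(e_t e_t')` into two sums that the grading separates: in `e_t · ∂e_t'`
all intersections lie inside `A.inter t`, while in `∂e_t · e_t'` none does, by `not_inf_le`. Hence
the partial boundary is determined by the product alone. -/
theorem mul'_rTensor_osBoundary (h : A.IsDecomposition I J) {t t' : List A.hyperplanes}
    (ht : A.inter t ∈ I) (ht' : A.inter t' ∈ J) :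
    osBoundary (osList K A t) * osList K A t' =
      gradeProj (fun X => ¬ X ≤ A.inter t) (osBoundary (osList K A t * osList K A t')) := by
  classical
  by_cases hdep : A.Dependent t
  · simp [osList_eq_zero_of_dependent hdep]
  have hne := h.inf_ne_bot _ ht _ ht'
  rw [← osList_append, osBoundary_osList_append (by rwa [inter_append]), map_add, map_smul]
  have h1 : gradeProj (fun X => ¬ X ≤ A.inter t) (osList K A t * osBoundary (osList K A t')) =
      0 := by
    rw [osBoundary_osList_eq_sum (h.ne_bot_right ht'), Finset.mul_sum, map_sum]
    refine Finset.sum_eq_zero fun k _ => ?_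
    rw [mul_smul_comm, ← osList_append, map_smul, gradeProj_osList, if_neg, smul_zero]
    simp
  rw [h1, smul_zero, add_zero, osBoundary_osList_eq_sum (h.ne_bot_left ht), Finset.sum_mul,
    map_sum]
  refine Finset.sum_congr rfl fun k hk => ?_
  rw [smul_mul_assoc, ← osList_append, map_smul, gradeProj_osList, if_pos]
  rw [inter_append]
  exact h.not_inf_le ht ht' hdep (Finset.mem_range.1 hk)

/-- The Leibniz sign is `(-1) ^ t.length`. For independent `t'` the exponent below equals
`t.length`, and it depends only on the total length and on `A.inter t'`, so the sign is constant on
each graded piece. For dependent `t'` both sides vanish. -/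
theorem mul'_lTensor_osBoundary (h : A.IsDecomposition I J) {t t' : List A.hyperplanes}
    (ht : A.inter t ∈ I) (ht' : A.inter t' ∈ J) :
    osList K A t * osBoundary (osList K A t') =
      (-1 : K) ^ (t.length + t'.length - affineCodim (A.inter t')) •
      gradeProj (fun X => ¬ X ≤ A.inter t') (osBoundary (osList K A t * osList K A t')) := by
  classical
  by_cases hdep : A.Dependent t'
  · simp [osList_eq_zero_of_dependent hdep]
  have hne := h.inf_ne_bot _ ht _ ht'
  have hlen : t.length + t'.length - affineCodim (A.inter t') = t.length := by
    have h2 := A.affineCodim_inter_le (h.ne_bot_right ht')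
    have h3 : t'.length ≤ affineCodim (A.inter t') :=
      not_lt.1 fun h0 => hdep ⟨h.ne_bot_right ht', h0⟩
    omega
  rw [hlen, ← osList_append, osBoundary_osList_append (by rwa [inter_append]), map_add, map_smul]
  have h1 : gradeProj (fun X => ¬ X ≤ A.inter t') (osBoundary (osList K A t) * osList K A t') =
      0 := by
    rw [osBoundary_osList_eq_sum (h.ne_bot_left ht), Finset.sum_mul, map_sum]
    refine Finset.sum_eq_zero fun k _ => ?_
    rw [smul_mul_assoc, ← osList_append, map_smul, gradeProj_osList, if_neg, smul_zero]
    simp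
  rw [h1, zero_add, smul_smul, ← mul_pow, neg_one_mul, neg_neg, one_pow, one_smul,
    osBoundary_osList_eq_sum (h.ne_bot_right ht'), Finset.mul_sum, map_sum]
  refine Finset.sum_congr rfl fun k hk => ?_
  rw [mul_smul_comm, ← osList_append, map_smul, gradeProj_osList, if_pos]
  rw [inter_append, inf_comm]
  exact h.symm.not_inf_le ht' ht hdep (Finset.mem_range.1 hk)

/-- Injectivity of the multiplication at `X` follows from injectivity in lower degree if the
first ideal has a largest element below `X`. -/
theorem eq_zero_of_hasLeastAbove_left (h : A.IsDecomposition I J) {n : ℕ}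
    {X : AffineSubspace F V} (hX : A.HasLeastAbove I X)
    (ih : ∀ y ∈ Submodule.span K (tensorMonomials A I J K n), LinearMap.mul' K _ y = 0 → y = 0)
    {y : OrlikSolomon K A ⊗[K] OrlikSolomon K A}
    (hy : y ∈ Submodule.span K (tensorMonomialsAt A I J K (n + 1) X))
    (hy0 : LinearMap.mul' K _ y = 0) : y = 0 := by
  obtain ⟨Z, hZ, H, hZH, hXZ, hmin⟩ := hX
  -- All first factors have intersection `Z ≤ H`, so `e_H · ∂` acts on them as the identity and `y`
  -- is recovered from its partial boundary.
  have hrec : Set.EqOn (LinearMap.rTensor (OrlikSolomon K A) (LinearMap.mulLeft K (osList K A [H]))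
      ∘ₗ LinearMap.rTensor (OrlikSolomon K A) osBoundary)
      (LinearMap.id : OrlikSolomon K A ⊗[K] OrlikSolomon K A →ₗ[K] _)
      (Submodule.span K (tensorMonomialsAt A I J K (n + 1) X)) := by
    refine LinearMap.eqOn_span' ?_
    rintro _ ⟨t, t', ht, ht', hs, rfl, rfl⟩
    have := h.eq_of_inf_eq ht ht' hZ hXZ hmin
    subst this
    simp only [LinearMap.comp_apply, LinearMap.rTensor_tmul, LinearMap.mulLeft_apply,
      LinearMap.id_apply]
    rw [osList_singleton_mul_osBoundary (h.ne_bot_left ht) hZH]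
  -- The product of the partial boundary is a function of the product of `y`, so it vanishes with it
  -- and the inductive hypothesis applies.
  have hmul : Set.EqOn (LinearMap.mul' K _ ∘ₗ LinearMap.rTensor (OrlikSolomon K A) osBoundary)
      (gradeProj (fun X => ¬ X ≤ Z) ∘ₗ osBoundary ∘ₗ LinearMap.mul' K _)
      (Submodule.span K (tensorMonomialsAt A I J K (n + 1) X)) := by
    refine LinearMap.eqOn_span' ?_
    rintro _ ⟨t, t', ht, ht', hs, rfl, rfl⟩
    have := h.eq_of_inf_eq ht ht' hZ hXZ hmin
    subst this
    exact h.mul'_rTensor_osBoundary K ht ht'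
  have hmem : LinearMap.rTensor (OrlikSolomon K A) osBoundary y ∈
      Submodule.span K (tensorMonomials A I J K n) := by
    refine LinearMap.apply_mem_of_mem_span _ ?_ hy
    rintro _ ⟨t, t', ht, ht', hs, rfl, rfl⟩
    rw [LinearMap.rTensor_tmul,
      osBoundary_osList_eq_sum (h.ne_bot_left ht), TensorProduct.sum_tmul]
    refine Submodule.sum_mem _ fun k hk => ?_
    rw [← TensorProduct.smul_tmul']
    refine Submodule.smul_mem _ _ (Submodule.subset_span ⟨t.eraseIdx k, t',
      h.inter_mem_left _ ht _ (A.inter_le_inter_eraseIdx t k), ht', ?_, rfl⟩)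
    rw [List.length_eraseIdx_of_lt (Finset.mem_range.1 hk)]
    have := Finset.mem_range.1 hk
    omega
  have h0 := ih _ hmem (by
    have := hmul hy
    simp only [LinearMap.comp_apply] at this
    rw [this, hy0, map_zero, map_zero])
  have := hrec hy
  simp only [LinearMap.comp_apply, LinearMap.id_apply] at this
  rw [← this, h0, map_zero]

/-- Injectivity of the multiplication at `X` follows from injectivity in lower degree if the
second ideal has a largest element below `X`. -/
theorem eq_zero_of_hasLeastAbove_right (h : A.IsDecomposition I J) {n : ℕ}
    {X : AffineSubspace F V} (hX : A.HasLeastAbove J X)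
    (ih : ∀ y ∈ Submodule.span K (tensorMonomials A I J K n), LinearMap.mul' K _ y = 0 → y = 0)
    {y : OrlikSolomon K A ⊗[K] OrlikSolomon K A}
    (hy : y ∈ Submodule.span K (tensorMonomialsAt A I J K (n + 1) X))
    (hy0 : LinearMap.mul' K _ y = 0) : y = 0 := by
  obtain ⟨Z, hZ, H, hZH, hXZ, hmin⟩ := hX
  have heq : ∀ t t', A.inter t ∈ I → A.inter t' ∈ J → A.inter t ⊓ A.inter t' = X →
      A.inter t' = Z := by
    rintro t t' ht ht' rfl
    rw [inf_comm] at hXZ hmin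
    exact h.symm.eq_of_inf_eq ht' ht hZ hXZ hmin
  have hrec : Set.EqOn (LinearMap.lTensor (OrlikSolomon K A) (LinearMap.mulLeft K (osList K A [H]))
      ∘ₗ LinearMap.lTensor (OrlikSolomon K A) osBoundary)
      (LinearMap.id : OrlikSolomon K A ⊗[K] OrlikSolomon K A →ₗ[K] _)
      (Submodule.span K (tensorMonomialsAt A I J K (n + 1) X)) := by
    refine LinearMap.eqOn_span' ?_
    rintro _ ⟨t, t', ht, ht', hs, hX, rfl⟩
    have := heq t t' ht ht' hX
    subst this
    simp only [LinearMap.comp_apply, LinearMap.lTensor_tmul, LinearMap.mulLeft_apply,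
      LinearMap.id_apply]
    rw [osList_singleton_mul_osBoundary (h.ne_bot_right ht') hZH]
  have hmul : Set.EqOn (LinearMap.mul' K _ ∘ₗ LinearMap.lTensor (OrlikSolomon K A) osBoundary)
      ((-1 : K) ^ (n + 1 - affineCodim Z) •
        (gradeProj (fun X => ¬ X ≤ Z) ∘ₗ osBoundary ∘ₗ LinearMap.mul' K _))
      (Submodule.span K (tensorMonomialsAt A I J K (n + 1) X)) := by
    refine LinearMap.eqOn_span' ?_
    rintro _ ⟨t, t', ht, ht', hs, hX, rfl⟩
    have := heq t t' ht ht' hX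
    subst this
    rw [← hs]
    exact h.mul'_lTensor_osBoundary K ht ht'
  have hmem : LinearMap.lTensor (OrlikSolomon K A) osBoundary y ∈
      Submodule.span K (tensorMonomials A I J K n) := by
    refine LinearMap.apply_mem_of_mem_span _ ?_ hy
    rintro _ ⟨t, t', ht, ht', hs, rfl, rfl⟩
    rw [LinearMap.lTensor_tmul,
      osBoundary_osList_eq_sum (h.ne_bot_right ht'), TensorProduct.tmul_sum]
    refine Submodule.sum_mem _ fun k hk => ?_
    rw [TensorProduct.tmul_smul]
    refine Submodule.smul_mem _ _ (Submodule.subset_span ⟨t, t'.eraseIdx k, ht,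
      h.inter_mem_right _ ht' _ (A.inter_le_inter_eraseIdx t' k), ?_, rfl⟩)
    rw [List.length_eraseIdx_of_lt (Finset.mem_range.1 hk)]
    have := Finset.mem_range.1 hk
    omega
  have h0 := ih _ hmem (by
    have := hmul hy
    simp only [LinearMap.comp_apply, LinearMap.smul_apply] at this
    rw [this, hy0, map_zero, map_zero, smul_zero])
  have := hrec hy
  simp only [LinearMap.comp_apply, LinearMap.id_apply] at this
  rw [← this, h0, map_zero]

/-- If a sum of tensors in the different `tensorMonomialsAt` is killed by the multiplication, then
so is each of its summands. -/
theorem eq_zero_of_mul'_eq_zero_of_mem_iSup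
    {N : AffineSubspace F V → Submodule K (OrlikSolomon K A ⊗[K] OrlikSolomon K A)}
    (hN : ∀ X, ∃ S : Set (OrlikSolomon K A ⊗[K] OrlikSolomon K A), N X = Submodule.span K S ∧
      ∀ y ∈ S, ∃ t t', A.inter t ⊓ A.inter t' = X ∧ y = osList K A t ⊗ₜ[K] osList K A t')
    (hinj : ∀ X, ∀ y ∈ N X, LinearMap.mul' K _ y = 0 → y = 0)
    {y : OrlikSolomon K A ⊗[K] OrlikSolomon K A} (hy : y ∈ ⨆ X, N X)
    (hy0 : LinearMap.mul' K _ y = 0) : y = 0 := by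
  classical
  obtain ⟨f, hf, rfl⟩ := (Submodule.mem_iSup_iff_exists_finsupp _ _).1 hy
  refine Finset.sum_eq_zero fun X hX => hinj X _ (hf X) ?_
  -- The product of a tensor with join `Y` lies in degree `Y` of the grading by flats, so projecting
  -- to degree `X` isolates one summand.
  have hgrade : ∀ Y, gradeProj (fun W => W = X) (LinearMap.mul' K _ (f Y)) =
      if Y = X then LinearMap.mul' K _ (f Y) else 0 := by
    intro Y
    obtain ⟨S, hS, hS'⟩ := hN Y
    have : Set.EqOn (gradeProj (fun W => W = X) ∘ₗ LinearMap.mul' K (OrlikSolomon K A))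
        (if Y = X then LinearMap.mul' K (OrlikSolomon K A) else 0 :
          OrlikSolomon K A ⊗[K] OrlikSolomon K A →ₗ[K] OrlikSolomon K A) (Submodule.span K S) := by
      refine LinearMap.eqOn_span' fun z hz => ?_
      obtain ⟨t, t', rfl, rfl⟩ := hS' z hz
      rw [LinearMap.comp_apply, LinearMap.mul'_apply, ← osList_append, gradeProj_osList,
        inter_append]
      split_ifs
      · rw [LinearMap.mul'_apply, osList_append]
      · rfl
    have h1 := this (hS ▸ hf Y)
    rw [LinearMap.comp_apply] at h1
    rw [h1]
    split_ifs <;> rfl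
  have h2 := congrArg (gradeProj fun W => W = X) hy0
  rw [map_finsuppSum, Finsupp.sum, map_sum, map_zero] at h2
  simp only [hgrade, Finset.sum_ite_eq', if_pos hX] at h2
  exact h2

theorem mul'_injOn_span_tensorMonomials (h : A.IsDecomposition I J) (n : ℕ) :
    ∀ y ∈ Submodule.span K (tensorMonomials A I J K n), LinearMap.mul' K _ y = 0 → y = 0 := by
  induction n with
  | zero =>
    intro y hy hy0
    have hle : Submodule.span K (tensorMonomials A I J K 0) ≤
        Submodule.span K {osList K A [] ⊗ₜ[K] osList K A []} := by
      refine Submodule.span_mono ?_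
      rintro _ ⟨t, t', -, -, hs, rfl⟩
      obtain ⟨h1, h2⟩ := Nat.add_eq_zero_iff.1 hs
      rw [List.length_eq_zero_iff] at h1 h2
      rw [h1, h2]
      rfl
    obtain ⟨c, rfl⟩ := Submodule.mem_span_singleton.1 (hle hy)
    rw [map_smul, LinearMap.mul'_apply, ← osList_append, List.append_nil] at hy0
    rw [TensorProduct.smul_tmul', hy0, TensorProduct.zero_tmul]
  | succ n ih =>
    intro y hy hy0
    refine eq_zero_of_mul'_eq_zero_of_mem_iSup K
      (N := fun X => Submodule.span K (tensorMonomialsAt A I J K (n + 1) X))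
      (fun X => ⟨_, rfl, ?_⟩) (fun X z hz hz0 => ?_) ?_ hy0
    · rintro _ ⟨t, t', -, -, -, hX, rfl⟩
      exact ⟨t, t', hX, rfl⟩
    -- A join that occurs is the nonempty intersection of a nonempty list, which is what
    -- `hasLeastAbove` requires.
    · rcases Set.eq_empty_or_nonempty (tensorMonomialsAt A I J K (n + 1) X) with he | he
      · rw [he, Submodule.span_empty] at hz
        exact hz
      · obtain ⟨_, t, t', ht, ht', hs, hX, -⟩ := he
        have hne := h.inf_ne_bot _ ht _ ht'
        rw [← inter_append] at hX hne
        rw [← hX] at hz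
        have hnil : t ++ t' ≠ [] := fun h0 => by
          rw [← List.length_append, h0] at hs
          simp at hs
        rcases h.hasLeastAbove _ hnil hne with h1 | h1
        · exact h.eq_zero_of_hasLeastAbove_left K h1 ih hz hz0
        · exact h.eq_zero_of_hasLeastAbove_right K h1 ih hz hz0
    · refine Submodule.span_le.2 ?_ hy
      rintro _ ⟨t, t', ht, ht', hs, rfl⟩
      exact Submodule.mem_iSup_of_mem (A.inter t ⊓ A.inter t')
        (Submodule.subset_span ⟨t, t', ht, ht', hs, rfl, rfl⟩)

/-- The multiplication is injective on the span of the tensors of a monomial of `I` by a monomial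
of `J`. -/
theorem mul'_injOn (h : A.IsDecomposition I J) {y : OrlikSolomon K A ⊗[K] OrlikSolomon K A}
    (hy : y ∈ Submodule.span K {y | ∃ t t', A.inter t ∈ I ∧ A.inter t' ∈ J ∧
      y = osList K A t ⊗ₜ[K] osList K A t'})
    (hy0 : LinearMap.mul' K _ y = 0) : y = 0 := by
  refine eq_zero_of_mul'_eq_zero_of_mem_iSup K
    -- Independent `t` and `t'` have total length equal to the codimension of their join, and
    -- dependent ones give zero, so the flat `X` already fixes the degree.
    (N := fun X => Submodule.span K (tensorMonomialsAt A I J K (affineCodim X) X))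
    (fun X => ⟨_, rfl, ?_⟩) (fun X z hz hz0 => ?_) ?_ hy0
  · rintro _ ⟨t, t', -, -, -, hX, rfl⟩
    exact ⟨t, t', hX, rfl⟩
  · refine h.mul'_injOn_span_tensorMonomials K (affineCodim X) z (Submodule.span_mono ?_ hz) hz0
    rintro _ ⟨t, t', ht, ht', hs, -, rfl⟩
    exact ⟨t, t', ht, ht', hs, rfl⟩
  · refine Submodule.span_le.2 ?_ hy
    rintro _ ⟨t, t', ht, ht', rfl⟩
    by_cases hd : A.Dependent t
    · rw [osList_eq_zero_of_dependent hd, TensorProduct.zero_tmul]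
      exact zero_mem _
    by_cases hd' : A.Dependent t'
    · rw [osList_eq_zero_of_dependent hd', TensorProduct.tmul_zero]
      exact zero_mem _
    refine Submodule.mem_iSup_of_mem (A.inter t ⊓ A.inter t')
        (Submodule.subset_span ⟨t, t', ht, ht', ?_, rfl, rfl⟩)
    rw [h.affineCodim_inf _ ht _ ht']
    have h1 := A.affineCodim_inter_le (h.ne_bot_left ht)
    have h2 := A.affineCodim_inter_le (h.ne_bot_right ht')
    have h3 : t.length ≤ affineCodim (A.inter t) :=
      not_lt.1 fun h0 => hd ⟨h.ne_bot_left ht, h0⟩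
    have h4 : t'.length ≤ affineCodim (A.inter t') :=
      not_lt.1 fun h0 => hd' ⟨h.ne_bot_right ht', h0⟩
    omega

end IsDecomposition

end HyperplaneArrangement

/-! ### Realizations of the ideals and the tensor decomposition -/

namespace HyperplaneArrangement

variable {F V W U : Type*} [Field F] [AddCommGroup V] [Module F V] [AddCommGroup W] [Module F W]
  [AddCommGroup U] [Module F U]

/-- The hyperplanes of `B` correspond to the hyperplanes of `A` in `I`, in such a way that
the intersections in `I` correspond to the nonempty intersections of `B`, with the same
codimensions. -/
structure IsRealization (A : HyperplaneArrangement F V) (I : Set (AffineSubspace F V))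
    (B : HyperplaneArrangement F W) (β : B.hyperplanes → A.hyperplanes) : Prop where
  injective : Function.Injective β
  exists_of_mem : ∀ H : A.hyperplanes, (H : AffineSubspace F V) ∈ I → ∃ H', β H' = H
  inter_ne_bot_iff : ∀ l, B.inter l ≠ ⊥ ↔ A.inter (l.map β) ∈ I
  affineCodim_inter : ∀ l, B.inter l ≠ ⊥ →
    affineCodim (B.inter l) = affineCodim (A.inter (l.map β))

variable (K : Type*) [CommRing K] {A : HyperplaneArrangement F V} {B : HyperplaneArrangement F W}

/-- The map of exterior algebras induced by a map of hyperplanes. -/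
noncomputable def extMap (β : B.hyperplanes → A.hyperplanes) : E K B →ₐ[K] E K A :=
  ExteriorAlgebra.map (Finsupp.lmapDomain K K β)

theorem extMap_eList (β : B.hyperplanes → A.hyperplanes) (l : List B.hyperplanes) :
    extMap K β (eList K B l) = eList K A (l.map β) := by
  induction l with
  | nil => simp
  | cons H l ih =>
    rw [eList_cons, map_mul, ih, List.map_cons, eList_cons, extMap, eBasis,
      ExteriorAlgebra.map_apply_ι, Finsupp.lmapDomain_apply, Finsupp.mapDomain_single, eBasis]

theorem extMap_boundary_eList (β : B.hyperplanes → A.hyperplanes) (l : List B.hyperplanes) :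
    extMap K β (boundary K B (eList K B l)) = boundary K A (eList K A (l.map β)) := by
  rw [boundary_eList, boundary_eList, map_sum, List.length_map]
  refine Finset.sum_congr rfl fun k _ => ?_
  rw [map_smul, extMap_eList, List.eraseIdx_map]

/-- The map of exterior algebras that restricts to the hyperplanes in the image of an injective
map and kills the other ones. -/
noncomputable def extRestrict {β : B.hyperplanes → A.hyperplanes} (hβ : Function.Injective β) :
    E K A →ₐ[K] E K B :=
  ExteriorAlgebra.map (Finsupp.lcomapDomain β hβ)

theorem extRestrict_eBasis {β : B.hyperplanes → A.hyperplanes} (hβ : Function.Injective β)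
    (H : B.hyperplanes) : extRestrict K hβ (eBasis K A (β H)) = eBasis K B H := by
  rw [extRestrict, eBasis, ExteriorAlgebra.map_apply_ι, eBasis]
  congr 1
  exact Finsupp.comapDomain_single _ _ _ _

theorem extRestrict_eBasis_of_notMem {β : B.hyperplanes → A.hyperplanes}
    (hβ : Function.Injective β) {H : A.hyperplanes} (hH : H ∉ Set.range β) :
    extRestrict K hβ (eBasis K A H) = 0 := by
  rw [extRestrict, eBasis, ExteriorAlgebra.map_apply_ι]
  have h0 : Finsupp.lcomapDomain (R := K) β hβ (Finsupp.single H (1 : K)) = 0 :=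
    Finsupp.ext fun H' => Finsupp.single_eq_of_ne fun h => hH ⟨H', h⟩
  rw [h0, map_zero]

theorem extRestrict_eList {β : B.hyperplanes → A.hyperplanes} (hβ : Function.Injective β)
    (l : List B.hyperplanes) : extRestrict K hβ (eList K A (l.map β)) = eList K B l := by
  induction l with
  | nil => simp
  | cons H l ih =>
    rw [List.map_cons, eList_cons, map_mul, ih, extRestrict_eBasis, eList_cons]

theorem extRestrict_eList_of_notMem {β : B.hyperplanes → A.hyperplanes}
    (hβ : Function.Injective β) {l : List A.hyperplanes} (hl : ∀ l', List.map β l' ≠ l) :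
    extRestrict K hβ (eList K A l) = 0 := by
  induction l with
  | nil => exact absurd rfl (hl [])
  | cons H l ih =>
    rw [eList_cons, map_mul]
    by_cases hH : H ∈ Set.range β
    · obtain ⟨H', rfl⟩ := hH
      rw [ih fun l' hl' => hl (H' :: l') (by rw [List.map_cons, hl']), mul_zero]
    · rw [extRestrict_eBasis_of_notMem K hβ hH, zero_mul]

theorem extRestrict_boundary_eList {β : B.hyperplanes → A.hyperplanes}
    (hβ : Function.Injective β) (l : List B.hyperplanes) :
    extRestrict K hβ (boundary K A (eList K A (l.map β))) = boundary K B (eList K B l) := by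
  rw [boundary_eList, boundary_eList, map_sum, List.length_map]
  refine Finset.sum_congr rfl fun k _ => ?_
  rw [map_smul, List.eraseIdx_map, extRestrict_eList]

namespace IsRealization

variable {I J : Set (AffineSubspace F V)} {β : B.hyperplanes → A.hyperplanes}

theorem dependent_iff (h : A.IsRealization I B β) {l : List B.hyperplanes}
    (hl : B.inter l ≠ ⊥) (hI : ⊥ ∉ I) : B.Dependent l ↔ A.Dependent (l.map β) := by
  rw [Dependent, Dependent, h.affineCodim_inter l hl, List.length_map]
  refine and_congr_left fun _ => iff_of_true hl fun h0 => hI ?_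
  rw [← h0]
  exact (h.inter_ne_bot_iff l).1 hl

theorem exists_map_eq (h : A.IsRealization I B β) (hD : A.IsDecomposition I J)
    {l : List A.hyperplanes} (hl : A.inter l ∈ I) : ∃ l', List.map β l' = l := by
  have : l ∈ Set.range (List.map β) := by
    rw [Set.range_list_map]
    intro H hH
    refine h.exists_of_mem H ?_
    have h1 := hD.inter_mem_left _ hl [H] (by simpa using A.inter_le_of_mem hH)
    simpa using h1
  exact this

open Classical in
/-- The module of the Orlik–Solomon algebra of a realization embeds into that of `A`. -/
theorem exists_section [FiniteDimensional F V] (h : A.IsRealization I B β) (hI : ⊥ ∉ I) :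
    ∃ s : OrlikSolomon K B →ₗ[K] OrlikSolomon K A,
      ∀ l, s (osList K B l) = if A.inter (l.map β) ∈ I then osList K A (l.map β) else 0 := by
  obtain ⟨s, hs⟩ := exists_osLift
    -- The projection is essential: a list with empty intersection in `B` may have a nonempty
    -- intersection in `A`, though one outside `I`.
    (osProj K A ∘ₗ extProj K A (fun X => X ∈ I) ∘ₗ (extMap K β).toLinearMap)
    (fun l hl => by
      have : A.inter (l.map β) ∉ I := fun h0 => (h.inter_ne_bot_iff l).2 h0 hl
      simp [extMap_eList, extProj_eList, this])
    (fun t l t' hl => by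
      simp only [LinearMap.comp_apply, AlgHom.toLinearMap_apply, map_mul, extMap_eList,
        extMap_boundary_eList]
      exact osProj_extProj_mul_boundary_mul _ _ _ _ ((h.dependent_iff hl.1 hI).1 hl))
  refine ⟨s, fun l => ?_⟩
  rw [osList, hs]
  simp only [LinearMap.comp_apply, AlgHom.toLinearMap_apply, extMap_eList, extProj_eList]
  rw [apply_ite (osProj K A), map_zero, osList]

/-- The Orlik–Solomon algebra of `A` maps onto that of a realization. -/
theorem exists_retraction [FiniteDimensional F V] (h : A.IsRealization I B β)
    (hD : A.IsDecomposition I J) :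
    ∃ q : OrlikSolomon K A →ₗ[K] OrlikSolomon K B,
      ∀ l, q (osList K A (l.map β)) = osList K B l := by
  have hI : ⊥ ∉ I := fun h0 => hD.ne_bot_left h0 rfl
  have hnot : ∀ l, A.inter l ∉ I → osProj K B (extRestrict K h.injective (eList K A l)) = 0 := by
    intro l hl
    by_cases hl' : ∃ l', List.map β l' = l
    · obtain ⟨l', rfl⟩ := hl'
      rw [extRestrict_eList]
      exact osList_eq_zero_of_inter_eq_bot
        (not_not.1 fun h0 => hl ((h.inter_ne_bot_iff l').1 h0))
    · rw [extRestrict_eList_of_notMem K h.injective (not_exists.1 hl'), map_zero]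
  have hdep : ∀ l, A.Dependent l →
      osProj K B (extRestrict K h.injective (eList K A l)) = 0 := by
    intro l hl
    by_cases hlI : A.inter l ∈ I
    · obtain ⟨l', rfl⟩ := h.exists_map_eq hD hlI
      rw [extRestrict_eList]
      exact osList_eq_zero_of_dependent
        ((h.dependent_iff ((h.inter_ne_bot_iff l').2 hlI) hI).2 hl)
    · exact hnot l hlI
  obtain ⟨q, hq⟩ := exists_osLift (osProj K B ∘ₗ (extRestrict K h.injective).toLinearMap)
    (fun l hl => hnot l (hl ▸ hI))
    (fun t l t' hl => by
      simp only [LinearMap.comp_apply, AlgHom.toLinearMap_apply, map_mul, osProj_mul]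
      suffices h0 : osProj K B (extRestrict K h.injective (boundary K A (eList K A l))) = 0 by
        rw [h0, mul_zero, zero_mul]
      by_cases hlI : A.inter l ∈ I
      · obtain ⟨l', rfl⟩ := h.exists_map_eq hD hlI
        rw [extRestrict_boundary_eList]
        exact osProj_boundary_of_dependent
          ((h.dependent_iff ((h.inter_ne_bot_iff l').2 hlI) hI).2 hl)
      -- A term of the boundary either is dependent or has the intersection of `l`, which is outside
      -- `I`; both kinds are sent to zero.
      · rw [boundary_eList, map_sum, map_sum]
        refine Finset.sum_eq_zero fun k hk => ?_
        rw [map_smul, map_smul]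
        rcases hl.eraseIdx (Finset.mem_range.1 hk) with hk' | hk'
        · rw [hdep _ hk', smul_zero]
        · rw [hnot _ (hk' ▸ hlI), smul_zero])
  refine ⟨q, fun l => ?_⟩
  rw [osList, hq, LinearMap.comp_apply, AlgHom.toLinearMap_apply, extRestrict_eList, osList]

end IsRealization

theorem osDegree_mul_mem {p q : ℕ} {x y : OrlikSolomon K A} (hx : x ∈ osDegree K A p)
    (hy : y ∈ osDegree K A q) : x * y ∈ osDegree K A (p + q) := by
  rw [osDegree_eq_span] at hx hy ⊢
  have := Submodule.mul_mem_mul hx hy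
  rw [Submodule.span_mul_span] at this
  refine Submodule.span_mono ?_ this
  rintro _ ⟨_, ⟨l, rfl, rfl⟩, _, ⟨l', rfl, rfl⟩, rfl⟩
  exact ⟨l ++ l', List.length_append, osList_append K A _ _⟩

/-- The Orlik–Solomon algebra of an arrangement with a decomposition of its intersection poset is,
as a graded module, the tensor product of those of realizations of the two ideals. -/
theorem exists_linearEquiv_of_isRealization [FiniteDimensional F V]
    {C : HyperplaneArrangement F U} {I J : Set (AffineSubspace F V)}
    {β : B.hyperplanes → A.hyperplanes} {γ : C.hyperplanes → A.hyperplanes}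
    (hD : A.IsDecomposition I J) (hB : A.IsRealization I B β) (hC : A.IsRealization J C γ) :
    ∃ Φ : A.OrlikSolomon K ≃ₗ[K] B.OrlikSolomon K ⊗[K] C.OrlikSolomon K,
      ∀ p : ℕ, (A.osDegree K p).map (Φ : A.OrlikSolomon K →ₗ[K] _) = osTensorDegree K B C p := by
  classical
  obtain ⟨s, hs⟩ := hB.exists_section K fun h0 => hD.ne_bot_left h0 rfl
  obtain ⟨s', hs'⟩ := hC.exists_section K fun h0 => hD.ne_bot_right h0 rfl
  obtain ⟨q, hq⟩ := hB.exists_retraction K hD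
  obtain ⟨q', hq'⟩ := hC.exists_retraction K hD.symm
  have hqs : q ∘ₗ s = LinearMap.id := linearMap_ext_osList fun l => by
    rw [LinearMap.comp_apply, hs]
    split_ifs with hl
    · exact hq l
    · rw [map_zero, LinearMap.id_apply, osList_eq_zero_of_inter_eq_bot
        (not_not.1 fun h0 => hl ((hB.inter_ne_bot_iff l).1 h0))]
  have hqs' : q' ∘ₗ s' = LinearMap.id := linearMap_ext_osList fun l => by
    rw [LinearMap.comp_apply, hs']
    split_ifs with hl
    · exact hq' l
    · rw [map_zero, LinearMap.id_apply, osList_eq_zero_of_inter_eq_bot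
        (not_not.1 fun h0 => hl ((hC.inter_ne_bot_iff l).1 h0))]
  let Ψ : B.OrlikSolomon K ⊗[K] C.OrlikSolomon K →ₗ[K] A.OrlikSolomon K :=
    LinearMap.mul' K _ ∘ₗ TensorProduct.map s s'
  have hinj : Function.Injective Ψ := by
    refine (injective_iff_map_eq_zero Ψ).2 fun y hy => ?_
    have hmem : TensorProduct.map s s' y ∈ Submodule.span K
        {y | ∃ t t', A.inter t ∈ I ∧ A.inter t' ∈ J ∧
          y = osList K A t ⊗ₜ[K] osList K A t'} := by
      have h1 : ∀ x, s x ∈ Submodule.span K (osList K A '' {t | A.inter t ∈ I}) := by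
        intro x
        refine s.apply_mem_of_mem_span (S := Set.range (osList K B)) ?_
          (span_range_osList K B ▸ Submodule.mem_top)
        rintro _ ⟨l, rfl⟩
        rw [hs]
        split_ifs with hl
        · exact Submodule.subset_span ⟨_, hl, rfl⟩
        · exact zero_mem _
      have h2 : ∀ x, s' x ∈ Submodule.span K (osList K A '' {t | A.inter t ∈ J}) := by
        intro x
        refine s'.apply_mem_of_mem_span (S := Set.range (osList K C)) ?_
          (span_range_osList K C ▸ Submodule.mem_top)
        rintro _ ⟨l, rfl⟩
        rw [hs']
        split_ifs with hl
        · exact Submodule.subset_span ⟨_, hl, rfl⟩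
        · exact zero_mem _
      clear hy
      induction y using TensorProduct.induction_on with
      | zero => simp
      | add a b ha hb =>
        rw [map_add]
        exact add_mem ha hb
      | tmul a b =>
        have h3 := Submodule.apply_mem_map₂ (TensorProduct.mk K _ _) (h1 a) (h2 b)
        rw [Submodule.map₂_span_span] at h3
        refine Submodule.span_mono ?_ h3
        rintro _ ⟨_, ⟨t, ht, rfl⟩, _, ⟨t', ht', rfl⟩, rfl⟩
        exact ⟨t, t', ht, ht', rfl⟩
    have h0 := hD.mul'_injOn K hmem hy
    -- The retractions make `s ⊗ s'` split injective, so no flatness over `K` is required.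
    have := congrArg (TensorProduct.map q q') h0
    rw [map_zero, ← LinearMap.comp_apply, ← TensorProduct.map_comp, hqs, hqs',
      TensorProduct.map_id] at this
    exact this
  have hprod : ∀ t t', A.inter t ∈ I → A.inter t' ∈ J → ∃ l l', l.length = t.length ∧
      l'.length = t'.length ∧
      Ψ (osList K B l ⊗ₜ[K] osList K C l') = osList K A t * osList K A t' := by
    intro t t' ht ht'
    obtain ⟨l, rfl⟩ := hB.exists_map_eq hD ht
    obtain ⟨l', rfl⟩ := hC.exists_map_eq hD.symm ht'
    refine ⟨l, l', (List.length_map _).symm, (List.length_map _).symm, ?_⟩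
    simp [Ψ, hs, hs', ht, ht']
  have hdeg : ∀ p, (osTensorDegree K B C p).map Ψ = A.osDegree K p := by
    intro p
    apply le_antisymm
    · rw [Submodule.map_le_iff_le_comap, osTensorDegree]
      refine iSup_le fun i => iSup_le fun j => iSup_le fun hij => ?_
      rw [TensorProduct.range_map_eq_span_tmul, Submodule.span_le]
      rintro _ ⟨m, n, rfl⟩
      subst hij
      have h1 : s m ∈ A.osDegree K i := by
        refine s.apply_mem_of_mem_span (S := osList K B '' {l | l.length = i}) ?_
          (osDegree_eq_span K B i ▸ m.2)
        rintro _ ⟨l, rfl, rfl⟩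
        rw [hs]
        split_ifs with hl
        · rw [osDegree_eq_span]
          exact Submodule.subset_span ⟨_, List.length_map _, rfl⟩
        · exact zero_mem _
      have h2 : s' n ∈ A.osDegree K j := by
        refine s'.apply_mem_of_mem_span (S := osList K C '' {l | l.length = j}) ?_
          (osDegree_eq_span K C j ▸ n.2)
        rintro _ ⟨l, rfl, rfl⟩
        rw [hs']
        split_ifs with hl
        · rw [osDegree_eq_span]
          exact Submodule.subset_span ⟨_, List.length_map _, rfl⟩
        · exact zero_mem _
      exact osDegree_mul_mem K h1 h2
    · rw [osDegree_eq_span, Submodule.span_le]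
      rintro _ ⟨l, rfl, rfl⟩
      refine Submodule.span_le.2 ?_ (hD.osList_mem_span K l.length l rfl)
      rintro _ ⟨t, t', ht, ht', hsum, -, -, rfl⟩
      obtain ⟨r, r', hr, hr', h1⟩ := hprod t t' ht ht'
      refine ⟨_, ?_, h1⟩
      refine Submodule.mem_iSup_of_mem r.length (Submodule.mem_iSup_of_mem r'.length
        (Submodule.mem_iSup_of_mem (by rw [hr, hr', hsum]) ?_))
      refine ⟨⟨osList K B r, ?_⟩ ⊗ₜ[K] ⟨osList K C r', ?_⟩, rfl⟩
      · rw [osDegree_eq_span]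
        exact Submodule.subset_span ⟨r, rfl, rfl⟩
      · rw [osDegree_eq_span]
        exact Submodule.subset_span ⟨r', rfl, rfl⟩
  have hsurj : Function.Surjective Ψ := by
    rw [← LinearMap.range_eq_top, eq_top_iff, ← span_range_osList K A, Submodule.span_le]
    rintro _ ⟨l, rfl⟩
    have : osList K A l ∈ A.osDegree K l.length := by
      rw [osDegree_eq_span]
      exact Submodule.subset_span ⟨l, rfl, rfl⟩
    rw [← hdeg] at this
    exact LinearMap.map_le_range this
  refine ⟨(LinearEquiv.ofBijective Ψ ⟨hinj, hsurj⟩).symm, fun p => ?_⟩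
  have hid : ((LinearEquiv.ofBijective Ψ ⟨hinj, hsurj⟩).symm : A.OrlikSolomon K →ₗ[K] _) ∘ₗ Ψ =
      LinearMap.id :=
    LinearMap.ext (LinearEquiv.ofBijective Ψ ⟨hinj, hsurj⟩).symm_apply_apply
  rw [← hdeg p, ← Submodule.map_comp, hid, Submodule.map_id]

end HyperplaneArrangement

/-! ### Pullback of affine subspaces and generic translates -/

section AffineComap

variable {F V W : Type*} [Field F] [AddCommGroup V] [Module F V] [AddCommGroup W] [Module F W]

theorem AffineSubspace.direction_comap_of_ne_bot {X : AffineSubspace F V} {f : W →ᵃ[F] V}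
    (h : X.comap f ≠ ⊥) : (X.comap f).direction = X.direction.comap f.linear := by
  obtain ⟨p, hp⟩ := (AffineSubspace.nonempty_iff_ne_bot _).2 h
  ext w
  rw [← AffineSubspace.vadd_mem_iff_mem_direction w hp, Submodule.mem_comap,
    ← AffineSubspace.vadd_mem_iff_mem_direction _ (AffineSubspace.mem_comap.1 hp),
    AffineSubspace.mem_comap, AffineMap.map_vadd]

theorem AffineSubspace.comap_ne_bot_of_sup_eq_top {X : AffineSubspace F V} {f : W →ᵃ[F] V}
    (hX : X ≠ ⊥) (h : X.direction ⊔ LinearMap.range f.linear = ⊤) : X.comap f ≠ ⊥ := by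
  obtain ⟨x, hx⟩ := (AffineSubspace.nonempty_iff_ne_bot _).2 hX
  rw [← AffineSubspace.nonempty_iff_ne_bot]
  have hmem : f 0 - x ∈ X.direction ⊔ LinearMap.range f.linear := h ▸ Submodule.mem_top
  obtain ⟨a, ha, _, ⟨w, rfl⟩, hab⟩ := Submodule.mem_sup.1 hmem
  refine ⟨-w, ?_⟩
  rw [SetLike.mem_coe, AffineSubspace.mem_comap]
  have : f (-w) = a +ᵥ x := by
    have h1 := f.map_vadd 0 (-w)
    rw [vadd_eq_add, add_zero, vadd_eq_add, map_neg f.linear] at h1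
    rw [h1, vadd_eq_add, eq_sub_of_add_eq hab]
    abel
  rw [this]
  exact AffineSubspace.vadd_mem_of_mem_direction ha hx

theorem affineCodim_comap {X : AffineSubspace F V} {f : W →ᵃ[F] V}
    (hX : X ≠ ⊥) (h : X.direction ⊔ LinearMap.range f.linear = ⊤) :
    affineCodim (X.comap f) = affineCodim X := by
  have hsurj : Function.Surjective (X.direction.mkQ ∘ₗ f.linear) := by
    rw [← LinearMap.range_eq_top, LinearMap.range_comp]
    have := Submodule.map_mkQ_eq_top (p := X.direction) (p' := LinearMap.range f.linear)
    rw [this, h]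
  have hker : LinearMap.ker (X.direction.mkQ ∘ₗ f.linear) = (X.comap f).direction := by
    rw [LinearMap.ker_comp, Submodule.ker_mkQ, AffineSubspace.direction_comap_of_ne_bot
      (AffineSubspace.comap_ne_bot_of_sup_eq_top hX h)]
  rw [affineCodim, affineCodim, ← hker]
  exact (LinearMap.quotKerEquivOfSurjective _ hsurj).finrank_eq

/-- Every translate of a subspace is the image of an affine map from a coordinate space. -/
theorem exists_affineMap_range_linear_eq [FiniteDimensional F V] (D : Submodule F V) (v : V) :
    ∃ (m : ℕ) (f : (Fin m → F) →ᵃ[F] V), LinearMap.range f.linear = D ∧ ∀ w, f w - v ∈ D := by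
  let φ : (Fin (Module.finrank F D) → F) →ₗ[F] V :=
    D.subtype ∘ₗ (Module.finBasis F D).equivFun.symm.toLinearMap
  have hφ : LinearMap.range φ = D := by
    rw [LinearMap.range_comp, LinearEquiv.range, Submodule.map_top, Submodule.range_subtype]
  refine ⟨_, φ.toAffineMap + AffineMap.const F _ v, ?_, fun w => ?_⟩
  · rw [AffineMap.add_linear, AffineMap.const_linear, add_zero]
    exact hφ
  · have h1 : φ w ∈ LinearMap.range φ := LinearMap.mem_range_self φ w
    rw [hφ] at h1
    simpa using h1

/-- A general translate of a subspace misses finitely many affine subspaces that are not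
transversal to it. -/
theorem exists_forall_vsub_notMem [Infinite F] {S : Set (AffineSubspace F V)} (hS : S.Finite)
    (D : Submodule F V) :
    ∃ v : V, ∀ X ∈ S, X.direction ⊔ D ≠ ⊤ → ∀ x ∈ X, x - v ∉ D := by
  have hpt : ∀ X : AffineSubspace F V, ∃ x, X ≠ ⊥ → x ∈ X := fun X => by
    by_cases hX : X = ⊥
    · exact ⟨0, fun h => absurd hX h⟩
    · obtain ⟨x, hx⟩ := (AffineSubspace.nonempty_iff_ne_bot _).2 hX
      exact ⟨x, fun _ => hx⟩
  choose g hg using hpt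
  have hT : {X ∈ S | X.direction ⊔ D ≠ ⊤}.Finite := hS.subset (Set.sep_subset _ _)
  -- The translate `v + D` meets `X` only if `v` lies in the coset of `X.direction ⊔ D` through a
  -- point of `X`.
  obtain ⟨v, hv⟩ := exists_forall_sub_notMem hT.toFinset (fun X => X.direction ⊔ D) g
    fun X hX => (hT.mem_toFinset.1 hX).2
  refine ⟨v, fun X hX htop x hx hxv => ?_⟩
  refine hv X (hT.mem_toFinset.2 ⟨hX, htop⟩) ?_
  have hne : X ≠ ⊥ := (AffineSubspace.nonempty_iff_ne_bot X).1 ⟨x, hx⟩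
  have h2 := AffineSubspace.vsub_mem_direction hx (hg _ hne)
  have h4 : v - g X = (x -ᵥ g X) + -(x - v) := by
    rw [vsub_eq_sub]
    abel
  rw [h4]
  exact Submodule.add_mem_sup h2 (neg_mem hxv)

end AffineComap

/-! ### Realizing an ideal by a generic section, and its intersection poset -/

namespace HyperplaneArrangement

variable {F V W : Type*} [Field F] [AddCommGroup V] [Module F V] [AddCommGroup W] [Module F W]

theorem finite_range_inter (A : HyperplaneArrangement F V) : (Set.range A.inter).Finite := by
  classical
  refine (Set.finite_range fun s : Finset A.hyperplanes => A.inter s.toList).subset ?_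
  rintro _ ⟨l, rfl⟩
  refine ⟨l.toFinset, le_antisymm (A.inter_anti ?_) (A.inter_anti ?_)⟩ <;>
    intro H hH <;> simpa using hH

theorem mem_flats_iff (A : HyperplaneArrangement F V) (X : AffineSubspace F V) :
    OrderDual.toDual X ∈ A.flats ↔ X ≠ ⊥ ∧ ∃ l, X = A.inter l := by
  classical
  refine and_congr_right fun _ => ⟨?_, ?_⟩
  · rintro ⟨S, hS, hX⟩
    refine ⟨(A.hyperplanes.attach.filter fun H => H.1 ∈ S).toList, ?_⟩
    refine Eq.trans hX (le_antisymm (A.le_inter_iff.2 fun H hH => sInf_le ?_)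
      (le_sInf fun H hH => ?_))
    · simpa using hH
    · exact A.inter_le_of_mem (H := ⟨H, hS hH⟩) (by simpa using hH)
  · rintro ⟨l, rfl⟩
    refine ⟨{H | ∃ H' ∈ l, H'.1 = H}, ?_, ?_⟩
    · rintro _ ⟨H, -, rfl⟩
      exact H.2
    · refine le_antisymm (le_sInf ?_) (A.le_inter_iff.2 fun H hH => sInf_le ⟨H, hH, rfl⟩)
      rintro _ ⟨H, hH, rfl⟩
      exact A.inter_le_of_mem hH

variable {A : HyperplaneArrangement F V} {I J : Set (AffineSubspace F V)}

namespace IsDecomposition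

variable [FiniteDimensional F V]

/-- If an intersection of hyperplanes of `I` is not in `I`, then it is not transversal to the
elements of `J` of maximal codimension. -/
theorem direction_sup_ne_top (hD : A.IsDecomposition I J) {Y : AffineSubspace F V} (hY : Y ∈ J)
    (hmax : ∀ Z ∈ J, affineCodim Z ≤ affineCodim Y) {l : List A.hyperplanes}
    (hl : ∀ H ∈ l, (H : AffineSubspace F V) ∈ I) (hne : A.inter l ≠ ⊥) (hnot : A.inter l ∉ I) :
    (A.inter l).direction ⊔ Y.direction ≠ ⊤ := by
  intro htop
  have hnil : l ≠ [] := by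
    rintro rfl
    exact hnot hD.top_mem_left
  -- A least element in `I` would lie below every hyperplane of `l`, forcing `A.inter l ∈ I`. So the
  -- least element `Z` is in `J`.
  rcases hD.hasLeastAbove l hnil hne with ⟨Z, hZ, -, -, -, hmin⟩ | ⟨Z, hZ, H, hZH, hlZ, -⟩
  · exact hnot (hD.inter_mem_left Z hZ l (A.le_inter_iff.2 fun H hH =>
      hmin H (hl H hH) (A.inter_le_of_mem hH)))
  obtain ⟨r, rfl⟩ := hD.exists_inter_right Y hY
  have hne' := inf_ne_bot_of_direction_sup_eq_top hne (hD.ne_bot_right hY) htop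
  rw [← inter_append] at hne'
  rcases hD.hasLeastAbove (l ++ r) (by simp [hnil]) hne' with
    ⟨Z', hZ', -, -, -, hmin⟩ | ⟨Z', hZ', -, -, -, hmin⟩
  · refine hnot (hD.inter_mem_left Z' hZ' l (A.le_inter_iff.2 fun H hH => hmin H (hl H hH) ?_))
    rw [inter_append]
    exact inf_le_left.trans (A.inter_le_of_mem hH)
  · rw [inter_append] at hmin
    -- By maximality of its codimension, `Y` is itself the least element of `J` above the join. Then
    -- `Y ≤ Z ≤ H`, so `A.inter l` and `Y` both lie in the hyperplane `H` and cannot be transversal.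
    have h1 : Z' = A.inter r := AffineSubspace.eq_of_le_of_affineCodim_le (hD.ne_bot_right hZ')
      (hmin _ hY inf_le_right) (hmax _ hZ')
    have h2 : A.inter r ≤ Z := h1 ▸ hmin Z hZ (inf_le_left.trans hlZ)
    have h3 := sup_le (AffineSubspace.direction_le (hlZ.trans hZH))
      (AffineSubspace.direction_le (h2.trans hZH))
    rw [htop, top_le_iff] at h3
    have h4 := affineCodim_add_finrank (H : AffineSubspace F V)
    rw [h3, finrank_top, A.codim_of_mem _ H.2] at h4
    omega

/-- The map parametrizes a generic translate of an element `Y` of `J` of maximal codimension.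
Additivity of codimension makes all of `I` transversal to it, and `direction_sup_ne_top` lets it
avoid the unwanted intersections. -/
theorem exists_affineMap [Infinite F] (hD : A.IsDecomposition I J) :
    ∃ (m : ℕ) (f : (Fin m → F) →ᵃ[F] V),
      (∀ X ∈ I, X.direction ⊔ LinearMap.range f.linear = ⊤) ∧
      ∀ l : List A.hyperplanes, (∀ H ∈ l, (H : AffineSubspace F V) ∈ I) →
        ((A.inter l).comap f ≠ ⊥ ↔ A.inter l ∈ I) := by
  classical
  have hfin : J.Finite := A.finite_range_inter.subset fun X hX => by
    obtain ⟨l, rfl⟩ := hD.exists_inter_right X hX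
    exact ⟨l, rfl⟩
  obtain ⟨Y, hY, hmax⟩ := Set.exists_max_image J affineCodim hfin ⟨⊤, hD.top_mem_right⟩
  obtain ⟨v, hv⟩ := exists_forall_vsub_notMem A.finite_range_inter Y.direction
  obtain ⟨m, f, hf, hfv⟩ := exists_affineMap_range_linear_eq Y.direction v
  have htr : ∀ X ∈ I, X.direction ⊔ LinearMap.range f.linear = ⊤ := fun X hX => by
    rw [hf, direction_sup_eq_top_iff (hD.inf_ne_bot X hX Y hY)]
    exact hD.affineCodim_inf X hX Y hY
  refine ⟨m, f, htr, fun l hl => ⟨fun hne => ?_, fun hmem =>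
    AffineSubspace.comap_ne_bot_of_sup_eq_top (hD.ne_bot_left hmem) (htr _ hmem)⟩⟩
  by_contra hnot
  have hne' : A.inter l ≠ ⊥ := fun h0 => hne (by rw [h0, AffineSubspace.comap_bot])
  have h1 := hD.direction_sup_ne_top hY hmax hl hne' hnot
  obtain ⟨w, hw⟩ := (AffineSubspace.nonempty_iff_ne_bot _).2 hne
  exact hv (A.inter l) ⟨l, rfl⟩ h1 (f w) (AffineSubspace.mem_comap.1 hw) (hfv w)

/-- The first ideal of a decomposition is realized by a hyperplane arrangement. -/
theorem exists_isRealization [Infinite F] (hD : A.IsDecomposition I J) :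
    ∃ (m : ℕ) (B : HyperplaneArrangement F (Fin m → F)) (β : B.hyperplanes → A.hyperplanes),
      A.IsRealization I B β := by
  classical
  obtain ⟨m, f, htr, hf⟩ := hD.exists_affineMap
  have hcodim : ∀ X ∈ I, affineCodim (X.comap f) = affineCodim X := fun X hX =>
    affineCodim_comap (hD.ne_bot_left hX) (htr X hX)
  have hbot : ∀ X ∈ I, X.comap f ≠ ⊥ := fun X hX =>
    AffineSubspace.comap_ne_bot_of_sup_eq_top (hD.ne_bot_left hX) (htr X hX)
  let B : HyperplaneArrangement F (Fin m → F) :=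
    { hyperplanes := (A.hyperplanes.filter fun H => H ∈ I).image fun H => H.comap f
      ne_bot_of_mem := by
        intro H hH
        obtain ⟨H', hH', rfl⟩ := Finset.mem_image.1 hH
        exact hbot H' (Finset.mem_filter.1 hH').2
      codim_of_mem := by
        intro H hH
        obtain ⟨H', hH', rfl⟩ := Finset.mem_image.1 hH
        rw [hcodim H' (Finset.mem_filter.1 hH').2]
        exact A.codim_of_mem H' (Finset.mem_filter.1 hH').1 }
  have hβ : ∀ H : B.hyperplanes, ∃ H' : A.hyperplanes, H'.1 ∈ I ∧ H'.1.comap f = H.1 := fun H => by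
    obtain ⟨H', hH', h⟩ := Finset.mem_image.1 H.2
    exact ⟨⟨H', (Finset.mem_filter.1 hH').1⟩, (Finset.mem_filter.1 hH').2, h⟩
  choose β hβI hβ using hβ
  have hcomap : ∀ l, (A.inter (l.map β)).comap f = B.inter l := by
    intro l
    induction l with
    | nil => exact AffineSubspace.comap_top
    | cons H l ih =>
      rw [List.map_cons, inter_cons, AffineSubspace.comap_inf, ih, hβ, inter_cons]
  have hiff : ∀ l, B.inter l ≠ ⊥ ↔ A.inter (l.map β) ∈ I := fun l => by
    rw [← hcomap, hf]
    intro H hH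
    obtain ⟨H', -, rfl⟩ := List.mem_map.1 hH
    exact hβI H'
  refine ⟨m, B, β, ?_, ?_, hiff, ?_⟩
  · intro H H' h
    rw [Subtype.ext_iff, ← hβ H, ← hβ H', h]
  · intro H hH
    let H' : B.hyperplanes :=
      ⟨H.1.comap f, Finset.mem_image_of_mem _ (Finset.mem_filter.2 ⟨H.2, hH⟩)⟩
    refine ⟨H', ?_⟩
    -- Two hyperplanes of `I` with the same pullback have an intersection that meets the section,
    -- hence lies in `I` and keeps its codimension, which is one. So they coincide.
    have h1 : (A.inter [H, β H']).comap f = H.1.comap f := by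
      rw [inter_cons, inter_cons, inter_nil, inf_top_eq, AffineSubspace.comap_inf, hβ H', inf_idem]
    have h2 : A.inter [H, β H'] ∈ I := by
      rw [← hf _ (by simp [hH, hβI H']), h1]
      exact hbot _ hH
    have h3 := hcodim _ h2
    rw [h1, hcodim _ hH, A.codim_of_mem _ H.2] at h3
    have h4 := AffineSubspace.eq_of_le_of_affineCodim_le (Y := H.1) (hD.ne_bot_left h2)
      (A.inter_le_of_mem (by simp)) (by rw [← h3, A.codim_of_mem _ H.2])
    have h5 := AffineSubspace.eq_of_le_of_affineCodim_le (Y := (β H').1) (hD.ne_bot_left h2)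
      (A.inter_le_of_mem (by simp)) (by rw [← h3, A.codim_of_mem _ (β H').2])
    exact Subtype.ext (h5.symm.trans h4)
  · intro l hl
    rw [← hcomap, hcodim _ ((hiff l).1 hl)]

end IsDecomposition

/-- Inclusion is detected by codimension: it holds exactly when appending `l'` to `l` leaves a
nonempty intersection of unchanged codimension, and a realization preserves both properties. -/
theorem IsRealization.inter_le_inter_iff [FiniteDimensional F V] [FiniteDimensional F W]
    {B : HyperplaneArrangement F W} {β : B.hyperplanes → A.hyperplanes}
    (h : A.IsRealization I B β) (hI : ⊥ ∉ I) {l l' : List B.hyperplanes} (hl : B.inter l ≠ ⊥) :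
    B.inter l ≤ B.inter l' ↔ A.inter (l.map β) ≤ A.inter (l'.map β) := by
  have hA := (h.inter_ne_bot_iff l).1 hl
  have happ : A.inter ((l ++ l').map β) = A.inter (l.map β) ⊓ A.inter (l'.map β) := by
    rw [List.map_append, inter_append]
  constructor
  · intro hle
    have h1 : B.inter (l ++ l') = B.inter l := by rw [inter_append, inf_eq_left.2 hle]
    have h2 : B.inter (l ++ l') ≠ ⊥ := h1 ▸ hl
    have h3 := (h.inter_ne_bot_iff _).1 h2
    have h4 := h.affineCodim_inter _ h2
    rw [h1, h.affineCodim_inter _ hl] at h4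
    rw [happ] at h3 h4
    rw [← inf_eq_left]
    exact AffineSubspace.eq_of_le_of_affineCodim_le (fun h0 => hI (h0 ▸ h3)) inf_le_left h4.ge
  · intro hle
    have h1 : A.inter ((l ++ l').map β) = A.inter (l.map β) := by rw [happ, inf_eq_left.2 hle]
    have h2 : B.inter (l ++ l') ≠ ⊥ := (h.inter_ne_bot_iff _).2 (h1 ▸ hA)
    have h4 := h.affineCodim_inter _ h2
    rw [h1, ← h.affineCodim_inter _ hl] at h4
    rw [inter_append] at h2 h4
    rw [← inf_eq_left]
    exact AffineSubspace.eq_of_le_of_affineCodim_le h2 inf_le_left h4.le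

/-- A realization of an ideal has an intersection poset isomorphic to it. -/
theorem IsRealization.nonempty_orderIso [FiniteDimensional F V] [FiniteDimensional F W]
    {B : HyperplaneArrangement F W} {β : B.hyperplanes → A.hyperplanes} {S : Set A.L}
    (hD : A.IsDecomposition (L.space '' S) J) (h : A.IsRealization (L.space '' S) B β) :
    Nonempty (B.L ≃o S) := by
  have hI : ⊥ ∉ L.space '' S := fun h0 => hD.ne_bot_left h0 rfl
  choose r hr using fun X : B.L => ((B.mem_flats_iff X.space).1 X.2).2
  have hne : ∀ X : B.L, B.inter (r X) ≠ ⊥ := fun X => hr X ▸ X.2.1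
  choose g hgS hg using fun X : B.L => (h.inter_ne_bot_iff (r X)).1 (hne X)
  refine ⟨RelIso.ofSurjective (OrderEmbedding.ofMapLEIff (fun X => (⟨g X, hgS X⟩ : S)) ?_) ?_⟩
  · intro X Y
    change (g Y).space ≤ (g X).space ↔ Y.space ≤ X.space
    rw [hg, hg, hr X, hr Y]
    exact (h.inter_le_inter_iff hI (hne Y)).symm
  · rintro ⟨X, hX⟩
    obtain ⟨l, hl⟩ := hD.exists_inter_left _ ⟨X, hX, rfl⟩
    have hlS : A.inter l ∈ L.space '' S := ⟨X, hX, hl⟩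
    obtain ⟨l', rfl⟩ := h.exists_map_eq hD hlS
    have hl' : B.inter l' ≠ ⊥ := (h.inter_ne_bot_iff l').2 hlS
    let Y : B.L := ⟨OrderDual.toDual (B.inter l'), (B.mem_flats_iff _).2 ⟨hl', l', rfl⟩⟩
    have hY : B.inter (r Y) = B.inter l' := (hr Y).symm
    refine ⟨Y, Subtype.ext (Subtype.ext ?_)⟩
    change (g Y).space = X.space
    rw [hg, hl]
    exact le_antisymm ((h.inter_le_inter_iff hI (hne Y)).1 hY.le)
      ((h.inter_le_inter_iff hI hl').1 hY.ge)

/-! ### From modular ideals to decompositions, and the main theorem -/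

/-- A modular ideal and its meet-complement, as sets of affine subspaces, decompose the
intersection poset. -/
theorem IsModularIdeal.isDecomposition [FiniteDimensional F V] {S : Set A.L} (h : IsModularIdeal S) :
    A.IsDecomposition (L.space '' S) (L.space '' meetCompl S) := by
  have hid : ∀ T : Set A.L, IsIdeal T → ⊤ ∈ L.space '' T := by
    rintro T ⟨⟨X, hX⟩, hT⟩
    exact ⟨⊥, hT bot_le hX, rfl⟩
  have hinter : ∀ (T : Set A.L), ∀ X ∈ L.space '' T, ∃ l, X = A.inter l := by
    rintro T _ ⟨X, -, rfl⟩
    exact ((A.mem_flats_iff X.space).1 X.2).2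
  have hmem : ∀ T : Set A.L, IsIdeal T → ∀ X ∈ L.space '' T, ∀ l, X ≤ A.inter l →
      A.inter l ∈ L.space '' T := by
    rintro T ⟨-, hT⟩ _ ⟨X, hX, rfl⟩ l hl
    have hne : A.inter l ≠ ⊥ := fun h0 => X.2.1 (le_bot_iff.1 (h0 ▸ hl))
    exact ⟨⟨OrderDual.toDual (A.inter l), (A.mem_flats_iff _).2 ⟨hne, l, rfl⟩⟩, hT hl hX, rfl⟩
  have hleast : ∀ (T : Set A.L) (X Z : A.L), Z ≠ ⊥ → T ∩ Set.Iic X = Set.Iic Z →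
      A.HasLeastAbove (L.space '' T) X.space := by
    intro T X Z hZ hT
    have hZT : Z ∈ T ∩ Set.Iic X := hT ▸ Set.mem_Iic.2 le_rfl
    obtain ⟨l, hl⟩ := ((A.mem_flats_iff Z.space).1 Z.2).2
    -- `Z ≠ ⊥` says that `Z` is not the whole space, so its list of hyperplanes is nonempty.
    obtain ⟨H, hH⟩ : ∃ H, H ∈ l := List.exists_mem_of_ne_nil l fun h0 => hZ (by
      refine Subtype.ext ?_
      rw [h0] at hl
      exact hl)
    refine ⟨Z.space, ⟨Z, hZT.1, rfl⟩, H, hl ▸ A.inter_le_of_mem hH, hZT.2, ?_⟩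
    rintro _ ⟨Y, hY, rfl⟩ hXY
    have : Y ∈ Set.Iic Z := hT ▸ ⟨hY, hXY⟩
    exact this
  have hI : IsIdeal S := h.isIdeal 0
  have hJ : IsIdeal (meetCompl S) := h.isIdeal 1
  have hpair : ∀ X ∈ S, ∀ Y ∈ meetCompl S, ∀ i, ![X, Y] i ∈ ![S, meetCompl S] i := by
    intro X hX Y hY i
    fin_cases i
    · exact hX
    · exact hY
  have hinf : ∀ X Y : A.L, ⨅ i, (![X, Y] i).space = X.space ⊓ Y.space := by
    intro X Y
    apply le_antisymm
    · exact le_inf (iInf_le (fun i => (![X, Y] i).space) 0) (iInf_le (fun i => (![X, Y] i).space) 1)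
    · refine le_iInf fun i => ?_
      fin_cases i
      · exact inf_le_left
      · exact inf_le_right
  refine ⟨hid _ hI, hid _ hJ, hinter _, hinter _, hmem _ hI, hmem _ hJ, ?_, ?_, ?_⟩
  · intro l hl hne
    let X : A.L := ⟨OrderDual.toDual (A.inter l), (A.mem_flats_iff _).2 ⟨hne, l, rfl⟩⟩
    have hX : X ≠ ⊥ := fun h0 => hl (A.inter_eq_top_iff.1 (congrArg L.space h0))
    obtain ⟨j, Z, hZ, hj⟩ := h.meet_condition X hX
    fin_cases j
    · exact Or.inl (hleast S X Z hZ hj)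
    · exact Or.inr (hleast (meetCompl S) X Z hZ hj)
  · rintro _ ⟨X, hX, rfl⟩ _ ⟨Y, hY, rfl⟩
    have := h.join_condition ![X, Y] (hpair X hX Y hY)
    rwa [hinf] at this
  · rintro _ ⟨X, hX, rfl⟩ _ ⟨Y, hY, rfl⟩
    have := h.rank_condition ![X, Y] (hpair X hX Y hY)
    rwa [hinf, Fin.sum_univ_two] at this

end HyperplaneArrangement

theorem mainTheorem8 {F V : Type*} [Field F] [Infinite F] [AddCommGroup V] [Module F V]
    [FiniteDimensional F V] (K : Type*) [CommRing K]
    (A : HyperplaneArrangement F V) (I : Set A.L)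
    (hI : HyperplaneArrangement.IsModularIdeal I) :
    ∃ (m n : ℕ) (B : HyperplaneArrangement F (Fin m → F)) (C : HyperplaneArrangement F (Fin n → F)),
      Nonempty (B.L ≃o I) ∧
      Nonempty (C.L ≃o HyperplaneArrangement.meetCompl I) ∧
      ∃ Φ : A.OrlikSolomon K ≃ₗ[K] B.OrlikSolomon K ⊗[K] C.OrlikSolomon K,
        ∀ p : ℕ, (A.osDegree K p).map (Φ : A.OrlikSolomon K →ₗ[K] _) =
          HyperplaneArrangement.osTensorDegree K B C p := by
  have hD := hI.isDecomposition
  obtain ⟨m, B, β, hB⟩ := hD.exists_isRealization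
  obtain ⟨n, C, γ, hC⟩ := hD.symm.exists_isRealization
  exact ⟨m, n, B, C, hB.nonempty_orderIso hD, hC.nonempty_orderIso hD.symm,
    HyperplaneArrangement.exists_linearEquiv_of_isRealization K hD hB hC⟩
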